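/- Let $k$ be a field of characteristic $p>0$, let $M=\mathbb Z^d$ and $M_{\mathbb R}=\mathbb R^d$, and let $\sigma\subset M_{\mathbb R}$ be a strongly convex rational polyhedral cone of full dimension $d$. Let $R=k[\sigma\cap M]$ be the associated normal toric ring and let $J$ be the ideal of $R$ generated by the monomials $X^m$ with $0\ne m\in\sigma\cap M$. Let $I=(X^{m_1},\dots,X^{m_s})$ with $s\ge 0$ and $m_i\in\sigma\cap M$. Put $$W_I=\bigcup_{i=1}^s (m_i+\sigma),\qquad LC_I=\{v\in M_{\mathbb R} : (v+\sigma)\setminus W_I \text{ has finite Lebesgue volume}\}.$$ For a ring $A$ of characteristic $p$ and finite Krull dimension, a maximal ideal $\mathfrak m$ of $A$ and a finitely generated $A$-module $N$, let $F^n(N)$ be the base change of $N$ along the $n$-th iterate of the Frobenius endomorphism of $A$, let $H^0_{\mathfrak m}(F^n(N))$ be the submodule of the elements killed by some power of $\mathfrak m$, and let $$e_{gHK}(N)=\lim_{n\to\infty}\frac{\ell_A\big(H^0_{\mathfrak m}(F^n(N))\big)}{p^{\,n\dim A}}$$ when this limit exists. Then $J$ is a maximal ideal; if $d\ne 1$,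 then $LC_I\subseteq\sigma$; the set $D=(LC_I\cap\sigma)\setminus W_I$ (which is $LC_I\setminus W_I$ when $d\neq 1$) is bounded; and $e_{gHK}(R/I)$ exists and $$e_{gHK}(R/I)=\operatorname{vol}(D),$$ both over $R$ with respect to $J$ and over the local ring $R_J$ (for the module $R_J/IR_J$, with respect to the maximal ideal of $R_J$). In particular $e_{gHK}(R/I)$ is rational. -/

import Mathlib

open MeasureTheory Filter
open scoped Topology ENNReal TensorProduct

noncomputable section

/-! ### The generalized Hilbert-Kunz multiplicity -/

/-- The ring `R`, regarded below as an `R`-algebra through the `n`-th iterate of Frobenius. -/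
def FrobeniusTwist (R : Type*) (_p _n : ℕ) : Type _ := R

namespace FrobeniusTwist

instance (R : Type*) [CommRing R] (p n : ℕ) : CommRing (FrobeniusTwist R p n) :=
  inferInstanceAs (CommRing R)

/-- The identity map, as a ring isomorphism. -/
def of (R : Type*) [CommRing R] (p n : ℕ) : R ≃+* FrobeniusTwist R p n := RingEquiv.refl R

/-- The structure map is `x ↦ x ^ (p ^ n)`. -/
instance (R : Type*) [CommRing R] (p n : ℕ) [ExpChar R p] : Algebra R (FrobeniusTwist R p n) :=
  ((of R p n : R →+* FrobeniusTwist R p n).comp (iterateFrobenius R p n)).toAlgebra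

end FrobeniusTwist

/-- `Fⁿ(M)`: the base change of the `R`-module `M` along the `n`-th iterate of Frobenius. It is a
module over the target `FrobeniusTwist R p n` of that base change, i.e. over `R`. -/
abbrev FrobeniusPullback (R : Type*) [CommRing R] (p n : ℕ) [ExpChar R p]
    (M : Type*) [AddCommGroup M] [Module R M] : Type _ :=
  FrobeniusTwist R p n ⊗[R] M

/-- `H⁰_𝔪(N)`: the submodule of the elements of `N` that are killed by some power of `𝔪`. -/
def zerothLocalCohomology {R : Type*} [CommRing R] (𝔪 : Ideal R)
    (N : Type*) [AddCommGroup N] [Module R N] : Submodule R N :=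
  ⨆ t : ℕ, Submodule.torsionBySet R N ((𝔪 ^ t : Ideal R) : Set R)

/-- The generalized Hilbert-Kunz function `n ↦ ℓ(H⁰_𝔪(Fⁿ(M)))` of `M`, with respect to the maximal
ideal `𝔪` of the ring `R` of characteristic `p`. -/
def gHKFunction (p : ℕ) (R : Type*) [CommRing R] [ExpChar R p] (𝔪 : Ideal R)
    (M : Type*) [AddCommGroup M] [Module R M] (n : ℕ) : ℕ∞ :=
  Module.length (FrobeniusTwist R p n)
    (zerothLocalCohomology (𝔪.map (FrobeniusTwist.of R p n)) (FrobeniusPullback R p n M))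

/-- The generalized Hilbert-Kunz multiplicity of `M` exists and equals `e`: the dimension `d` of `R`
is finite, and `ℓ(H⁰_𝔪(Fⁿ(M))) / p ^ (n * d)` tends to `e` as `n → ∞`. -/
def HasGHKMultiplicity (p : ℕ) (R : Type*) [CommRing R] [ExpChar R p] (𝔪 : Ideal R)
    (M : Type*) [AddCommGroup M] [Module R M] (e : ℝ≥0∞) : Prop :=
  ∃ d : ℕ, ringKrullDim R = d ∧
    Tendsto (fun n : ℕ => (gHKFunction p R 𝔪 M n : ℝ≥0∞) / (p : ℝ≥0∞) ^ (n * d)) atTop (𝓝 e)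

/-! ### Characteristic of the rings involved -/

instance AddMonoidAlgebra.instCharPOfField (k S : Type*) [Field k] [AddCommMonoid S] (p : ℕ)
    [CharP k p] : CharP (AddMonoidAlgebra k S) p :=
  charP_of_injective_algebraMap (algebraMap k (AddMonoidAlgebra k S)).injective p

instance Localization.AtPrime.instCharP (R : Type*) [CommRing R] (p : ℕ) [Fact p.Prime] [CharP R p]
    (P : Ideal R) [P.IsPrime] : CharP (Localization.AtPrime P) p := by
  have h0 : (p : Localization.AtPrime P) = 0 := by
    rw [← map_natCast (algebraMap R (Localization.AtPrime P)) p, CharP.cast_eq_zero, map_zero]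
  exact (CharP.charP_iff_prime_eq_zero Fact.out).2 h0

/-! ### Cones, toric rings and monomial ideals -/

/-- The inclusion of the lattice `M = ℤᵈ` in `M_ℝ = ℝᵈ`. -/
def latticeEmbedding (d : ℕ) : (Fin d → ℤ) →+ (Fin d → ℝ) :=
  (Int.castAddHom ℝ).compLeft (Fin d)

/-- A rational polyhedral cone: generated by finitely many lattice points. -/
def IsRationalPolyhedralCone {d : ℕ} (σ : PointedCone ℝ (Fin d → ℝ)) : Prop :=
  ∃ T : Finset (Fin d → ℤ), σ = PointedCone.hull ℝ (latticeEmbedding d '' (T : Set (Fin d → ℤ)))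

/-- The monoid `σ ∩ M` of the lattice points of the cone `σ`. -/
def coneMonoid {d : ℕ} (σ : PointedCone ℝ (Fin d → ℝ)) : AddSubmonoid (Fin d → ℤ) :=
  σ.toAddSubmonoid.comap (latticeEmbedding d)

/-- A point of `σ ∩ M` as a vector of `M_ℝ`. -/
def conePoint {d : ℕ} {σ : PointedCone ℝ (Fin d → ℝ)} (m : coneMonoid σ) : Fin d → ℝ :=
  latticeEmbedding d (m : Fin d → ℤ)

/-- The normal toric ring `k[σ ∩ M]`. -/
abbrev ToricRing (k : Type*) [Field k] {d : ℕ} (σ : PointedCone ℝ (Fin d → ℝ)) : Type _ :=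
  AddMonoidAlgebra k (coneMonoid σ)

/-- The ideal `J` of the toric ring that is generated by the monomials `X ^ m` with `m ≠ 0`. -/
def toricMaximalIdeal (k : Type*) [Field k] {d : ℕ} (σ : PointedCone ℝ (Fin d → ℝ)) :
    Ideal (ToricRing k σ) :=
  Ideal.span {x | ∃ m : coneMonoid σ, m ≠ 0 ∧ x = AddMonoidAlgebra.single m (1 : k)}

/-- The monomial ideal `(X ^ m₁, …, X ^ mₛ)`. -/
def monomialIdeal (k : Type*) [Field k] {d : ℕ} {σ : PointedCone ℝ (Fin d → ℝ)} {s : ℕ}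
    (m : Fin s → coneMonoid σ) : Ideal (ToricRing k σ) :=
  Ideal.span (Set.range fun i => AddMonoidAlgebra.single (m i) (1 : k))

/-- The translate `v + σ`. -/
def translatedCone {d : ℕ} (σ : PointedCone ℝ (Fin d → ℝ)) (v : Fin d → ℝ) : Set (Fin d → ℝ) :=
  (fun x => v + x) '' (σ : Set (Fin d → ℝ))

/-- `W_I`, the union of the cones `mᵢ + σ`. -/
def coneUnion {d : ℕ} {σ : PointedCone ℝ (Fin d → ℝ)} {s : ℕ} (m : Fin s → coneMonoid σ) :
    Set (Fin d → ℝ) :=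
  ⋃ i, translatedCone σ (conePoint (m i))

/-- `LC_I`, the set of the points `v` of `M_ℝ` such that `(v + σ) \ W_I` has finite volume. -/
def finiteColengthLocus {d : ℕ} {σ : PointedCone ℝ (Fin d → ℝ)} {s : ℕ}
    (m : Fin s → coneMonoid σ) : Set (Fin d → ℝ) :=
  {v | volume (translatedCone σ v \ (translatedCone σ v ∩ coneUnion m)) < ∞}

end

/-! Put `q = pⁿ`. The Frobenius pullback of `R/I` is `R/I^[q]`, where `I^[q]` is generated by the
monomials `X^(q mᵢ)`. A monomial `X^a` lies in `I^[q]` exactly when `a/q ∈ W_I`, and modulo `I^[q]`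
it is killed by a power of `J` exactly when `a/q ∈ LC_I`. Hence the local cohomology has as
`k`-basis the monomials with `a/q ∈ D`. Since `R/J = k`, its length is the number of such `a`, and
the limit is a lattice point count for `D`, with exponent `dim R = d`.

The link between volume and algebra is a pair of descriptions of `LC_I`. A point `v` is in `LC_I` if
and only if, along every generator `w` of `σ`, the ray from `v` enters `W_I` (`EntersUnion`); this
is what killing by a power of `J` sees. Equivalently, for every `w` some `mᵢ` satisfies `⟨u, mᵢ⟩ ≤
⟨u, v⟩` for all defining inequalities `u` that vanish on `w` (`LocusIneqs`). The second form shows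
that `D` is bounded and is decided by the signs of finitely many integral affine forms. So its
frontier is null, the count divided by `q^d` tends to `vol(D)`, and `vol(D)` is rational because a
simplex containing `D` can be cut into rational simplices on which the forms have constant sign up
to a null set.

The local statement follows because elements outside `J` are invertible modulo every `J^t`, so
localization does not change `J`-power torsion. -/

/-! ### Sets cut out by rational affine forms -/

section RationalPolyhedra

variable {d : ℕ}

/-- The affine form `x ↦ ⟨u, x⟩ - c` attached to `h = (u, c)`. -/
noncomputable def affineForm (h : (Fin d → ℤ) × ℤ) : (Fin d → ℝ) →ᵃ[ℝ] ℝ :=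
  (∑ i, (h.1 i : ℝ) • LinearMap.proj (R := ℝ) (φ := fun _ : Fin d => ℝ) i).toAffineMap -
    AffineMap.const ℝ (Fin d → ℝ) (h.2 : ℝ)

theorem affineForm_apply (h : (Fin d → ℤ) × ℤ) (x : Fin d → ℝ) :
    affineForm h x = ∑ i, (h.1 i : ℝ) * x i - h.2 := by
  simp [affineForm]

/-- Membership in `E` depends only on the signs of the affine forms in `H`. -/
def IsDeterminedBy (H : Finset ((Fin d → ℤ) × ℤ)) (E : Set (Fin d → ℝ)) : Prop :=
  ∀ x y, (∀ h ∈ H, 0 ≤ affineForm h x ↔ 0 ≤ affineForm h y) → x ∈ E → y ∈ E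

theorem continuous_affineForm (h : (Fin d → ℤ) × ℤ) : Continuous (affineForm h) := by
  have : (affineForm h : (Fin d → ℝ) → ℝ) = fun x => ∑ i, (h.1 i : ℝ) * x i - h.2 :=
    funext (affineForm_apply h)
  rw [this]; fun_prop

/-- `E` is the preimage of a set of sign patterns under a measurable map to a finite type. -/
theorem IsDeterminedBy.measurableSet {H : Finset ((Fin d → ℤ) × ℤ)} {E : Set (Fin d → ℝ)}
    (hE : IsDeterminedBy H E) : MeasurableSet E := by
  classical
  let f : (Fin d → ℝ) → (H → Prop) := fun x h => 0 ≤ affineForm h.1 x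
  have hf : Measurable f := by
    refine measurable_pi_iff.2 fun h => ?_
    exact measurableSet_setOfPred.1 (measurableSet_le measurable_const
      (continuous_affineForm h.1).measurable)
  have : E = f ⁻¹' (f '' E) := by
    ext y
    refine ⟨fun hy => ⟨y, hy, rfl⟩, ?_⟩
    rintro ⟨x, hx, hxy⟩
    exact hE x y (fun h hh => iff_of_eq (congrFun hxy ⟨h, hh⟩)) hx
  rw [this]
  exact hf (Set.toFinite _).measurableSet

theorem volume_affineMap_eq_zero (g : (Fin d → ℝ) →ᵃ[ℝ] ℝ) (x : Fin d → ℝ) (hx : g x ≠ 0) :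
    volume {y | g y = 0} = 0 := by
  have h : ({y | g y = 0} : Set (Fin d → ℝ)) =
      ((AffineSubspace.mk' (0 : ℝ) ⊥).comap g : AffineSubspace ℝ (Fin d → ℝ)) := by
    ext y; simp
  rw [h]
  refine Measure.addHaar_affineSubspace _ _ fun htop => hx ?_
  have : x ∈ (AffineSubspace.mk' (0 : ℝ) ⊥).comap g := by rw [htop]; trivial
  simpa using this

/-- The zero loci of the nonzero affine forms in `H` form a null set. -/
theorem volume_affineForm_zeros (H : Finset ((Fin d → ℤ) × ℤ)) :
    volume (⋃ h ∈ H, {x | affineForm h x = 0 ∧ ∃ y, affineForm h y ≠ 0}) = 0 := by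
  refine (measure_biUnion_null_iff H.countable_toSet).2 ?_
  intro h _
  by_cases hh : ∃ y, affineForm h y ≠ 0
  · obtain ⟨y, hy⟩ := hh
    exact measure_mono_null (fun x hx => hx.1) (volume_affineMap_eq_zero _ y hy)
  · simp [hh]

/-- Near a point where every vanishing form of `H` vanishes identically, all signs are locally
constant. So the frontier lies in finitely many hyperplanes. -/
theorem IsDeterminedBy.volume_frontier {H : Finset ((Fin d → ℤ) × ℤ)} {E : Set (Fin d → ℝ)}
    (hE : IsDeterminedBy H E) : volume (frontier E) = 0 := by
  refine measure_mono_null ?_ (volume_affineForm_zeros H)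
  intro x hx
  by_contra hcon
  simp only [Set.mem_iUnion, Set.mem_ofPred_eq, not_exists, not_and] at hcon
  have hev : ∀ᶠ y in 𝓝 x, ∀ h ∈ H, (0 ≤ affineForm h x ↔ 0 ≤ affineForm h y) := by
    rw [Filter.eventually_all_finset]
    intro h hh
    by_cases h0 : affineForm h x = 0
    · refine Eventually.of_forall fun y => ?_
      have := hcon h hh h0 y
      rw [h0, not_not.1 this]
    · rcases lt_or_gt_of_ne h0 with h1 | h1
      · filter_upwards [(continuous_affineForm h).continuousAt.eventually_lt
          continuousAt_const h1] with y hy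
        exact ⟨fun h2 => absurd h1 (not_lt.2 h2), fun h2 => absurd hy (not_lt.2 h2)⟩
      · filter_upwards [continuousAt_const.eventually_lt
          (continuous_affineForm h).continuousAt h1] with y hy
        exact ⟨fun _ => hy.le, fun _ => h1.le⟩
  by_cases hxE : x ∈ E
  · exact hx.2 (mem_interior_iff_mem_nhds.2 (hev.mono fun y hy => hE x y hy hxE))
  · have : Eᶜ ∈ 𝓝 x := hev.mono fun y hy hyE => hxE (hE y x (fun h hh => (hy h hh).symm) hyE)
    exact (mem_closure_iff_nhds.1 hx.1 _ this).elim fun z hz => hz.1 hz.2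

/-! ### Edge subdivision of simplices -/

theorem mem_convexHull_range_iff {ι E : Type*} [Fintype ι] [AddCommGroup E] [Module ℝ E]
    {w : ι → E} {x : E} :
    x ∈ convexHull ℝ (Set.range w) ↔
      ∃ l : ι → ℝ, (∀ i, 0 ≤ l i) ∧ ∑ i, l i = 1 ∧ ∑ i, l i • w i = x := by
  classical
  constructor
  · have : Set.range w = (Fintype.linearCombination ℝ w) ''
        Set.range (fun i j : ι => if i = j then (1 : ℝ) else 0) := by
      rw [← Set.range_comp]
      congr 1; ext i
      simp [Fintype.linearCombination_apply]
    rw [this, ← LinearMap.image_convexHull, convexHull_basis_eq_stdSimplex]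
    rintro ⟨l, hl, rfl⟩
    exact ⟨l, hl.1, hl.2, rfl⟩
  · rintro ⟨l, h0, h1, rfl⟩
    exact mem_convexHull_of_exists_fintype l w h0 h1 (fun i => ⟨i, rfl⟩) rfl

/-- The new vertex `(1 - s) w a + s w b` takes the weight `μ = l a / (1 - s)`, which absorbs all the
weight of `w a` and uses up `μ s` of the weight of `w b`. The hypothesis `hle` says that enough
weight is left on `w b`. -/
theorem mem_convexHull_update {ι E : Type*} [Fintype ι] [DecidableEq ι] [AddCommGroup E]
    [Module ℝ E] (w : ι → E) {a b : ι} (hab : a ≠ b) {s : ℝ} (hs1 : s < 1)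
    {l : ι → ℝ} (h0 : ∀ i, 0 ≤ l i) (h1 : ∑ i, l i = 1) (hle : l a * s ≤ l b * (1 - s)) :
    ∑ i, l i • w i ∈
      convexHull ℝ (Set.range (Function.update w a ((1 - s) • w a + s • w b))) := by
  set μ : ℝ := l a / (1 - s) with hμ
  have hs : (0 : ℝ) < 1 - s := by linarith
  have hμa : μ * (1 - s) = l a := by rw [hμ]; field_simp
  have hμ0 : 0 ≤ μ := div_nonneg (h0 a) hs.le
  have hμb : μ * s ≤ l b := by
    have : μ * s * (1 - s) ≤ l b * (1 - s) := by
      calc μ * s * (1 - s) = μ * (1 - s) * s := by ring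
        _ ≤ _ := by rw [hμa]; exact hle
    exact le_of_mul_le_mul_right this hs
  refine mem_convexHull_range_iff.2
    ⟨fun i => l i + ((if i = a then μ - l a else 0) + (if i = b then - (μ * s) else 0)), ?_, ?_, ?_⟩
  · intro i
    by_cases hia : i = a
    · subst hia; simp [hab, hμ0]
    · by_cases hib : i = b
      · subst hib; simp [hia, hμb]
      · simp [hia, hib, h0 i]
  · simp only [Finset.sum_add_distrib, h1, Finset.sum_ite_eq', Finset.mem_univ, if_true]
    linarith
  · have hw : Function.update w a ((1 - s) • w a + s • w b) =
        fun i => w i + if i = a then (s • (w b - w a)) else 0 := by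
      funext i
      by_cases hia : i = a
      · subst hia; simp; module
      · simp [hia]
    rw [hw]
    simp only [smul_add, add_smul, Finset.sum_add_distrib, ite_smul, zero_smul, smul_ite, smul_zero,
      Finset.sum_ite_eq', Finset.mem_univ, if_true, add_zero, if_neg hab]
    have : l a = μ * (1 - s) := hμa.symm
    rw [this]
    module

theorem convexHull_range_update_subset {ι E : Type*} [Fintype ι] [DecidableEq ι] [AddCommGroup E]
    [Module ℝ E] (w : ι → E) (a b c : ι) {s : ℝ} (hs0 : 0 ≤ s) (hs1 : s ≤ 1) :
    convexHull ℝ (Set.range (Function.update w c ((1 - s) • w a + s • w b))) ⊆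
      convexHull ℝ (Set.range w) := by
  refine convexHull_min ?_ (convex_convexHull ℝ _)
  rintro _ ⟨i, rfl⟩
  by_cases hi : i = c
  · subst hi
    rw [Function.update_self]
    exact convex_convexHull ℝ _ (subset_convexHull ℝ _ (Set.mem_range_self a))
      (subset_convexHull ℝ _ (Set.mem_range_self b)) (by linarith) hs0 (by ring)
  · rw [Function.update_of_ne hi]
    exact subset_convexHull ℝ _ (Set.mem_range_self i)

theorem convexHull_range_eq_union {ι E : Type*} [Fintype ι] [DecidableEq ι] [AddCommGroup E]
    [Module ℝ E] (w : ι → E) {a b : ι} (hab : a ≠ b) {s : ℝ} (hs0 : 0 < s) (hs1 : s < 1) :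
    convexHull ℝ (Set.range w) =
      convexHull ℝ (Set.range (Function.update w a ((1 - s) • w a + s • w b))) ∪
      convexHull ℝ (Set.range (Function.update w b ((1 - s) • w a + s • w b))) := by
  apply Set.Subset.antisymm
  · intro x hx
    obtain ⟨l, h0, h1, rfl⟩ := mem_convexHull_range_iff.1 hx
    rcases le_total (l a * s) (l b * (1 - s)) with h | h
    · exact Or.inl (mem_convexHull_update w hab hs1 h0 h1 h)
    · right
      have := mem_convexHull_update w hab.symm (s := 1 - s) (by linarith) h0 h1
        (by rw [sub_sub_cancel]; exact h)
      rwa [sub_sub_cancel, add_comm] at this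
  · exact Set.union_subset (convexHull_range_update_subset w a b a hs0.le hs1.le)
      (convexHull_range_update_subset w a b b hs0.le hs1.le)

theorem affineMap_nonneg_of_mem_convexHull {ι E : Type*} [AddCommGroup E] [Module ℝ E]
    {w : ι → E} (g : E →ᵃ[ℝ] ℝ) (h : ∀ i, 0 ≤ g (w i)) {x : E}
    (hx : x ∈ convexHull ℝ (Set.range w)) : 0 ≤ g x := by
  have hc : Convex ℝ {y | 0 ≤ g y} := (convex_Ici (0 : ℝ)).affine_preimage g
  exact convexHull_min (t := {y | 0 ≤ g y}) (by rintro _ ⟨i, rfl⟩; exact h i) hc hx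

/-- For a nondegenerate simplex, the affine form that is `s` at `w a`, `-(1 - s)` at `w b` and `0`
at the other vertices vanishes at the new vertex and separates the two pieces, so they meet inside a
hyperplane. A degenerate simplex is itself null. -/
theorem convexHull_update_inter_null (w : Fin (d + 1) → Fin d → ℝ) {a b : Fin (d + 1)}
    (hab : a ≠ b) {s : ℝ} (hs0 : 0 < s) (hs1 : s < 1) :
    volume (convexHull ℝ (Set.range (Function.update w a ((1 - s) • w a + s • w b))) ∩
      convexHull ℝ (Set.range (Function.update w b ((1 - s) • w a + s • w b)))) = 0 := by
  by_cases htop : affineSpan ℝ (Set.range w) = ⊤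
  · have hind : AffineIndependent ℝ w := by
      rw [affineIndependent_iff_finrank_vectorSpan_eq ℝ w (n := d) (by simp)]
      rw [← direction_affineSpan, htop, AffineSubspace.direction_top]
      simp
    let B : AffineBasis (Fin (d + 1)) ℝ (Fin d → ℝ) := ⟨w, hind, htop⟩
    have hB : ∀ i, w i = B i := fun i => rfl
    let g : (Fin d → ℝ) →ᵃ[ℝ] ℝ := s • B.coord a - (1 - s) • B.coord b
    have ga : g (w a) = s := by
      simp [g, hB, AffineBasis.coord_apply_ne _ hab.symm]
    have gb : g (w b) = -(1 - s) := by
      simp [g, hB, AffineBasis.coord_apply_ne _ hab]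
    have gi : ∀ i, i ≠ a → i ≠ b → g (w i) = 0 := by
      intro i hia hib
      simp [g, hB, AffineBasis.coord_apply_ne _ hia.symm, AffineBasis.coord_apply_ne _ hib.symm]
    have gq : g ((1 - s) • w a + s • w b) = 0 := by
      have : (1 - s) • w a + s • w b = AffineMap.lineMap (w a) (w b) s := by
        rw [AffineMap.lineMap_apply_module]
      rw [this, AffineMap.apply_lineMap, AffineMap.lineMap_apply_module, ga, gb]
      simp only [smul_eq_mul]; ring
    refine measure_mono_null ?_ (volume_affineMap_eq_zero g (w a) (by rw [ga]; exact hs0.ne'))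
    rintro x ⟨hx1, hx2⟩
    have h2 : 0 ≤ g x := by
      refine affineMap_nonneg_of_mem_convexHull g (fun i => ?_) hx2
      by_cases hib : i = b
      · subst hib; rw [Function.update_self, gq]
      · rw [Function.update_of_ne hib]
        by_cases hia : i = a
        · subst hia; rw [ga]; exact hs0.le
        · rw [gi i hia hib]
    have h1 : 0 ≤ (-g) x := by
      refine affineMap_nonneg_of_mem_convexHull (-g) (fun i => ?_) hx1
      change 0 ≤ -(g _)
      by_cases hia : i = a
      · subst hia; rw [Function.update_self, gq]; simp
      · rw [Function.update_of_ne hia]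
        by_cases hib : i = b
        · subst hib; rw [gb]; linarith
        · rw [gi i hia hib]; simp
    have h1' : 0 ≤ -(g x) := h1
    exact le_antisymm (by linarith) h2
  · refine measure_mono_null ?_ (Measure.addHaar_affineSubspace volume _ htop)
    exact fun x hx => convexHull_subset_affineSpan _
      (convexHull_range_update_subset w a b a hs0.le hs1.le hx.1)

/-! ### Volumes of bounded rational polyhedral sets -/

/-- The vertices `0, e₁, …, e_d` of the corner simplex. -/
def cornerVertex (d : ℕ) : Fin (d + 1) → Fin d → ℝ := Fin.cons 0 (fun i => Pi.single i 1)

/-- The real points with given rational coordinates. -/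
def realVertices {ι : Type*} (v : ι → Fin d → ℚ) : ι → Fin d → ℝ := fun i j => (v i j : ℝ)

/-- `x` is a rational multiple of the volume of the corner simplex. -/
def IsCornerMultiple (d : ℕ) (x : ℝ) : Prop :=
  ∃ r : ℚ, x = r * volume.real (convexHull ℝ (Set.range (cornerVertex d)))

theorem IsCornerMultiple.add {x y : ℝ} (hx : IsCornerMultiple d x) (hy : IsCornerMultiple d y) :
    IsCornerMultiple d (x + y) := by
  obtain ⟨r, rfl⟩ := hx
  obtain ⟨s, rfl⟩ := hy
  exact ⟨r + s, by push_cast; ring⟩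

/-- The simplex is the image of the corner simplex under an affine map with rational matrix, which
scales volume by the absolute value of the determinant. -/
theorem isCornerMultiple_volume_simplex (v : Fin (d + 1) → Fin d → ℚ) :
    IsCornerMultiple d (volume.real (convexHull ℝ (Set.range (realVertices v)))) := by
  let A : Matrix (Fin d) (Fin d) ℚ := Matrix.of fun j i => v i.succ j - v 0 j
  let L : (Fin d → ℝ) →ₗ[ℝ] (Fin d → ℝ) := Matrix.toLin' (A.map (Rat.castHom ℝ))
  let T : (Fin d → ℝ) →ᵃ[ℝ] (Fin d → ℝ) :=
    L.toAffineMap + AffineMap.const ℝ (Fin d → ℝ) (realVertices v 0)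
  have hT : ∀ x, T x = L x + realVertices v 0 := fun x => rfl
  have hrange : Set.range (realVertices v) = T '' Set.range (cornerVertex d) := by
    rw [← Set.range_comp]
    congr 1
    funext i
    refine Fin.cases ?_ (fun i => ?_) i
    · simp [hT, cornerVertex]
    · ext j
      simp [hT, cornerVertex, L, A, realVertices]
  have himage : convexHull ℝ (Set.range (realVertices v)) =
      (fun x => x + realVertices v 0) '' (L '' convexHull ℝ (Set.range (cornerVertex d))) := by
    rw [hrange, ← AffineMap.image_convexHull, Set.image_image]
    rfl
  refine ⟨|A.det|, ?_⟩
  rw [himage, measureReal_def, Set.image_add_right, measure_preimage_add_right,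
    Measure.addHaar_image_linearMap, ENNReal.toReal_mul, ENNReal.toReal_ofReal (abs_nonneg _)]
  have hdet : LinearMap.det L = (A.det : ℝ) := by
    rw [LinearMap.det_toLin']
    exact (RingHom.map_det (Rat.castHom ℝ) A).symm
  rw [hdet, measureReal_def]
  push_cast
  rfl

theorem affineForm_realVertices {ι : Type*} (h : (Fin d → ℤ) × ℤ) (v : ι → Fin d → ℚ) (i : ι) :
    ∃ r : ℚ, affineForm h (realVertices v i) = r :=
  ⟨∑ j, (h.1 j : ℚ) * v i j - h.2, by simp [affineForm_apply, realVertices]⟩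

theorem isBounded_convexHull_range {ι : Type*} [Finite ι] (w : ι → Fin d → ℝ) :
    Bornology.IsBounded (convexHull ℝ (Set.range w)) :=
  isBounded_convexHull.2 (Set.finite_range w).isBounded

/-- The signs of an affine form at the vertices of a simplex are not strictly mixed. -/
def IsOneSigned {ι : Type*} (h : (Fin d → ℤ) × ℤ) (w : ι → Fin d → ℝ) : Prop :=
  (∀ i, 0 ≤ affineForm h (w i)) ∨ ∀ i, affineForm h (w i) ≤ 0

theorem affineForm_nonpos_of_mem_convexHull {ι : Type*} {w : ι → Fin d → ℝ}
    (h : (Fin d → ℤ) × ℤ) (hw : ∀ i, affineForm h (w i) ≤ 0) {x : Fin d → ℝ}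
    (hx : x ∈ convexHull ℝ (Set.range w)) : affineForm h x ≤ 0 := by
  have : 0 ≤ (-affineForm h) x :=
    affineMap_nonneg_of_mem_convexHull _ (fun i => by
      change 0 ≤ -(affineForm h (w i)); linarith [hw i]) hx
  have h2 : 0 ≤ -(affineForm h x) := this
  linarith

theorem IsOneSigned.of_subset {ι : Type*} {h : (Fin d → ℤ) × ℤ} {w w' : ι → Fin d → ℝ}
    (hw : IsOneSigned h w)
    (hsub : convexHull ℝ (Set.range w') ⊆ convexHull ℝ (Set.range w)) : IsOneSigned h w' := by
  have hmem : ∀ i, w' i ∈ convexHull ℝ (Set.range w) :=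
    fun i => hsub (subset_convexHull ℝ _ (Set.mem_range_self i))
  rcases hw with hw | hw
  · exact Or.inl fun i => affineMap_nonneg_of_mem_convexHull _ hw (hmem i)
  · exact Or.inr fun i => affineForm_nonpos_of_mem_convexHull _ hw (hmem i)

/-- Outside the null set where some nonconstant form vanishes, all points of the simplex have the
same signs. So, up to a null set, the simplex is inside `E` or misses it. -/
theorem volume_inter_of_isOneSigned {H : Finset ((Fin d → ℤ) × ℤ)} {E : Set (Fin d → ℝ)}
    (hE : IsDeterminedBy H E) {w : Fin (d + 1) → Fin d → ℝ} (hw : ∀ h ∈ H, IsOneSigned h w) :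
    volume (convexHull ℝ (Set.range w) ∩ E) = volume (convexHull ℝ (Set.range w)) ∨
      volume (convexHull ℝ (Set.range w) ∩ E) = 0 := by
  set S := convexHull ℝ (Set.range w)
  set Z : Set (Fin d → ℝ) := ⋃ h ∈ H, {x | affineForm h x = 0 ∧ ∃ y, affineForm h y ≠ 0}
  have hZ : volume Z = 0 := volume_affineForm_zeros H
  have hsame : ∀ x ∈ S \ Z, ∀ y ∈ S \ Z, ∀ h ∈ H, (0 ≤ affineForm h x ↔ 0 ≤ affineForm h y) := by
    intro x hx y hy h hh
    rcases hw h hh with hs | hs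
    · exact ⟨fun _ => affineMap_nonneg_of_mem_convexHull _ hs hy.1,
        fun _ => affineMap_nonneg_of_mem_convexHull _ hs hx.1⟩
    · have key : ∀ x ∈ S \ Z, ∀ y, 0 ≤ affineForm h x → 0 ≤ affineForm h y := by
        intro x hx y h0
        have hx0 := le_antisymm (affineForm_nonpos_of_mem_convexHull h hs hx.1) h0
        by_contra hy0
        exact hx.2 (Set.mem_iUnion₂.2 ⟨h, hh, hx0, y, fun h' => hy0 h'.ge⟩)
      exact ⟨key x hx y, key y hy x⟩
  by_cases hne : ((S \ Z) ∩ E).Nonempty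
  · left
    obtain ⟨x, hx, hxE⟩ := hne
    refine le_antisymm (measure_mono Set.inter_subset_left) ?_
    calc volume S = volume (S \ Z) := (measure_sdiff_null hZ).symm
      _ ≤ _ := measure_mono fun y hy => Set.mem_inter hy.1 (hE x y (hsame x hx y hy) hxE)
  · right
    refine measure_mono_null (fun y hy => ?_) hZ
    by_contra hyZ
    exact hne ⟨y, ⟨hy.1, hyZ⟩, hy.2⟩

/-- Cut the simplex until every form is one-signed on it. The outer induction runs over the forms
that may still have mixed signs; cutting never spoils a one-signed form, because the pieces are
contained in the simplex. -/
theorem isCornerMultiple_volume_inter {H : Finset ((Fin d → ℤ) × ℤ)} {E : Set (Fin d → ℝ)}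
    (hE : IsDeterminedBy H E) (v : Fin (d + 1) → Fin d → ℚ) :
    IsCornerMultiple d (volume.real (convexHull ℝ (Set.range (realVertices v)) ∩ E)) := by
  classical
  suffices key : ∀ L : Finset ((Fin d → ℤ) × ℤ), ∀ v : Fin (d + 1) → Fin d → ℚ,
      (∀ h ∈ H, h ∉ L → IsOneSigned h (realVertices v)) →
      IsCornerMultiple d (volume.real (convexHull ℝ (Set.range (realVertices v)) ∩ E)) from
    key H v fun h h1 h2 => absurd h1 h2
  intro L
  induction L using Finset.induction_on with
  | empty =>
    intro v hv
    rcases volume_inter_of_isOneSigned hE (fun h hh => hv h hh (by simp)) with h | h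
    · rw [measureReal_def, h]; exact isCornerMultiple_volume_simplex v
    · rw [measureReal_def, h]; exact ⟨0, by simp⟩
  | insert h L _ ih =>
    -- The inner induction counts the vertices where `h` does not vanish. Cutting an edge with
    -- opposite signs at its ends, at the zero of `h`, replaces such a vertex by one where `h`
    -- vanishes.
    have inner : ∀ n : ℕ, ∀ v : Fin (d + 1) → Fin d → ℚ,
        (Finset.univ.filter fun i => affineForm h (realVertices v i) ≠ 0).card = n →
        (∀ h' ∈ H, h' ∉ insert h L → IsOneSigned h' (realVertices v)) →
        IsCornerMultiple d (volume.real (convexHull ℝ (Set.range (realVertices v)) ∩ E)) := by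
      intro n
      induction n using Nat.strong_induction_on with
      | _ n ihn =>
        intro v hn hv
        by_cases hone : IsOneSigned h (realVertices v)
        · refine ih v fun h' hh' hL => ?_
          by_cases heq : h' = h
          · rw [heq]; exact hone
          · exact hv h' hh' (by simp [heq, hL])
        · simp only [IsOneSigned, not_or, not_forall, not_le] at hone
          obtain ⟨⟨b, hb⟩, ⟨a, ha⟩⟩ := hone
          have hab : a ≠ b := by rintro rfl; linarith
          obtain ⟨α, hα⟩ := affineForm_realVertices h v a
          obtain ⟨β, hβ⟩ := affineForm_realVertices h v b
          rw [hα] at ha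
          rw [hβ] at hb
          have ha' : (0 : ℚ) < α := by exact_mod_cast ha
          have hb' : β < 0 := by exact_mod_cast hb
          -- The solution of `(1 - s) α + s β = 0`, rational because `α` and `β` are; thus the new
          -- vertex has rational coordinates.
          set s : ℚ := α / (α - β) with hs
          have hpos : 0 < α - β := by linarith
          have hs0 : 0 < s := div_pos ha' hpos
          have hs1 : s < 1 := (div_lt_one hpos).2 (by linarith)
          have hs0' : (0 : ℝ) < s := by exact_mod_cast hs0
          have hs1' : (s : ℝ) < 1 := by exact_mod_cast hs1
          set q : Fin d → ℚ := (1 - s) • v a + s • v b with hq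
          have hupd : ∀ c, realVertices (Function.update v c q) =
              Function.update (realVertices v) c
                ((1 - (s : ℝ)) • realVertices v a + (s : ℝ) • realVertices v b) := by
            intro c
            funext i j
            by_cases hi : i = c
            · subst hi; simp [realVertices, hq]
            · simp [realVertices, hi]
          have hhq : affineForm h ((1 - (s : ℝ)) • realVertices v a + (s : ℝ) • realVertices v b)
              = 0 := by
            rw [← AffineMap.lineMap_apply_module, AffineMap.apply_lineMap,
              AffineMap.lineMap_apply_module, hα, hβ, hs]
            have : (α : ℝ) - β ≠ 0 := by exact_mod_cast hpos.ne'
            push_cast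
            simp only [smul_eq_mul]
            field_simp
            ring
          have hrec : ∀ c, affineForm h (realVertices v c) ≠ 0 →
              IsCornerMultiple d (volume.real
                (convexHull ℝ (Set.range (realVertices (Function.update v c q))) ∩ E)) := by
            intro c hc
            refine ihn _ ?_ _ rfl fun h' hh' hL => (hv h' hh' hL).of_subset ?_
            · rw [← hn]
              refine Finset.card_lt_card ⟨fun i hi => ?_, fun hsub => ?_⟩
              · rw [Finset.mem_filter] at hi ⊢
                refine ⟨hi.1, ?_⟩
                by_cases hic : i = c
                · rw [hic]; exact hc
                · have := hi.2
                  rwa [hupd, Function.update_of_ne hic] at this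
              · have := hsub (Finset.mem_filter.2 ⟨Finset.mem_univ c, hc⟩)
                rw [Finset.mem_filter, hupd, Function.update_self] at this
                exact this.2 hhq
            · rw [hupd]
              exact convexHull_range_update_subset _ a b c hs0'.le hs1'.le
          have hsplit := convexHull_range_eq_union (realVertices v) hab hs0' hs1'
          have hnull := convexHull_update_inter_null (realVertices v) hab hs0' hs1'
          have h1 := hrec a (by rw [hα]; exact ha.ne')
          have h2 := hrec b (by rw [hβ]; exact hb.ne)
          rw [hupd] at h1 h2
          have hfin : ∀ (w : Fin (d + 1) → Fin d → ℝ),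
              volume (convexHull ℝ (Set.range w) ∩ E) ≠ ∞ := fun w =>
            ((isBounded_convexHull_range w).subset Set.inter_subset_left).measure_lt_top.ne
          rw [hsplit, Set.union_inter_distrib_right, measureReal_def, measure_union₀,
            ENNReal.toReal_add (hfin _) (hfin _)]
          · exact h1.add h2
          · exact (((Set.finite_range _).isCompact_convexHull (𝕜 := ℝ)).measurableSet.inter
              hE.measurableSet).nullMeasurableSet
          · exact measure_mono_null (fun x hx => Set.mem_inter hx.1.1 hx.2.1) hnull
    intro v hv
    exact inner _ v rfl hv

theorem exists_simplex_superset {E : Set (Fin d → ℝ)} (hE : Bornology.IsBounded E) :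
    ∃ v : Fin (d + 1) → Fin d → ℚ, E ⊆ convexHull ℝ (Set.range (realVertices v)) := by
  obtain ⟨r, hr⟩ := hE.exists_norm_le
  obtain ⟨N, hN⟩ := exists_nat_gt r
  have hN0 : (0 : ℝ) ≤ N := N.cast_nonneg
  -- The simplex has vertices `(-N, …, -N)` and its translates by `K eᵢ`, with barycentric
  -- coordinates `(x j + N) / K`. As `x j + N ≤ 2 N`, their sum is at most `1`; the summand `+ 1`
  -- keeps `K` positive when `N` or `d` is `0`.
  set K : ℕ := 2 * N * d + 1
  have hK : (0 : ℝ) < K := by positivity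
  refine ⟨Fin.cons (fun _ => -(N : ℚ)) fun i => fun j => -(N : ℚ) + if i = j then (K : ℚ) else 0,
    fun x hx => ?_⟩
  have hxN : ∀ j, |x j| ≤ N := fun j => (norm_le_pi_norm x j).trans ((hr x hx).trans hN.le)
  have hlow : ∀ j, 0 ≤ x j + N := fun j => by linarith [(abs_le.1 (hxN j)).1]
  refine mem_convexHull_range_iff.2
    ⟨Fin.cons (1 - ∑ j, (x j + N) / K) fun j => (x j + N) / K, fun i => ?_, ?_, ?_⟩
  · refine Fin.cases ?_ (fun i => ?_) i
    · rw [Fin.cons_zero, sub_nonneg, ← Finset.sum_div, div_le_one hK]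
      calc ∑ j, (x j + N) ≤ ∑ _j : Fin d, (2 * N : ℝ) :=
            Finset.sum_le_sum fun j _ => by linarith [(abs_le.1 (hxN j)).2]
        _ = 2 * N * d := by simp; ring
        _ ≤ K := by simp [K]
    · rw [Fin.cons_succ]; exact div_nonneg (hlow i) hK.le
  · rw [Fin.sum_univ_succ]; simp
  · funext j
    rw [Fin.sum_univ_succ]
    simp only [Fin.cons_zero, Fin.cons_succ, Pi.add_apply, Pi.smul_apply, Finset.sum_apply,
      realVertices, smul_eq_mul]
    push_cast
    simp only [mul_add, Finset.sum_add_distrib, ← Finset.sum_mul]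
    have hsingle : ∑ i, (x i + N) / K * ((if i = j then (K : ℚ) else 0 : ℚ) : ℝ) = x j + N := by
      rw [Finset.sum_eq_single j (fun i _ hi => by simp [hi]) (by simp)]
      simp only [if_true, Rat.cast_natCast]
      field_simp
    rw [hsingle]
    ring

theorem isDeterminedBy_unitCube :
    IsDeterminedBy ((Finset.univ.image fun i : Fin d => ((Pi.single i 1 : Fin d → ℤ), (0 : ℤ))) ∪
      Finset.univ.image fun i : Fin d => ((-Pi.single i 1 : Fin d → ℤ), (-1 : ℤ)))
      (Set.Icc (0 : Fin d → ℝ) 1) := by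
  intro x y h hx
  have h1 : ∀ (i : Fin d) (z : Fin d → ℝ), affineForm (Pi.single i 1, 0) z = z i := by
    intro i z
    simp [affineForm_apply, Pi.single_apply]
  have h2 : ∀ (i : Fin d) (z : Fin d → ℝ), affineForm (-Pi.single i 1, -1) z = 1 - z i := by
    intro i z
    simp [affineForm_apply, Pi.single_apply]
    ring
  constructor
  · intro i
    have := h _ (Finset.mem_union_left _ (Finset.mem_image_of_mem _ (Finset.mem_univ i)))
    rw [h1, h1] at this
    exact this.1 (hx.1 i)
  · intro i
    have := h _ (Finset.mem_union_right _ (Finset.mem_image_of_mem _ (Finset.mem_univ i)))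
    rw [h2, h2] at this
    have h3 := this.1 (sub_nonneg.2 (hx.2 i))
    exact sub_nonneg.1 h3

/-- A bounded set cut out by finitely many rational affine forms has rational volume. -/
theorem IsDeterminedBy.exists_rat_volume {H : Finset ((Fin d → ℤ) × ℤ)} {E : Set (Fin d → ℝ)}
    (hE : IsDeterminedBy H E) (hb : Bornology.IsBounded E) :
    ∃ r : NNRat, volume E = ((r : NNReal) : ℝ≥0∞) := by
  have hmul : ∀ {H : Finset ((Fin d → ℤ) × ℤ)} {E : Set (Fin d → ℝ)}, IsDeterminedBy H E →
      Bornology.IsBounded E → IsCornerMultiple d (volume.real E) := by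
    intro H E hE hb
    obtain ⟨v, hv⟩ := exists_simplex_superset hb
    have := isCornerMultiple_volume_inter hE v
    rwa [Set.inter_eq_right.2 hv] at this
  -- The volume of the corner simplex need not be known: the unit cube has volume `1` and is a
  -- rational multiple of it, so it cancels.
  obtain ⟨r, hr⟩ := hmul isDeterminedBy_unitCube (Metric.isBounded_Icc (0 : Fin d → ℝ) 1)
  have hone : volume.real (Set.Icc (0 : Fin d → ℝ) 1) = 1 := by
    simp [measureReal_def, Real.volume_Icc_pi]
  rw [hone] at hr
  obtain ⟨t, ht⟩ := hmul hE hb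
  set c := volume.real (convexHull ℝ (Set.range (cornerVertex d)))
  have hr0 : (r : ℝ) ≠ 0 := by rintro h0; rw [h0, zero_mul] at hr; exact one_ne_zero hr
  have hval : volume.real E = ((t / r : ℚ) : ℝ) := by
    rw [ht, eq_inv_of_mul_eq_one_right hr.symm]; push_cast; rw [div_eq_mul_inv]
  have hnn : 0 ≤ t / r := by
    have : (0 : ℝ) ≤ ((t / r : ℚ) : ℝ) := hval ▸ measureReal_nonneg
    exact_mod_cast this
  refine ⟨⟨t / r, hnn⟩, ?_⟩
  rw [← ENNReal.ofReal_toReal hb.measure_lt_top.ne, ← measureReal_def, hval]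
  rw [ENNReal.ofReal, ENNReal.coe_inj]
  apply NNReal.eq
  rw [Real.coe_toNNReal _ (by exact_mod_cast hnn)]
  rfl

end RationalPolyhedra

/-! ### Presentations of rational polyhedral cones -/

section ConeGeometry

variable {d : ℕ}

/-- The linear form `x ↦ ⟨u, x⟩` of a lattice vector `u`. -/
noncomputable def dotForm (u : Fin d → ℤ) : (Fin d → ℝ) →ₗ[ℝ] ℝ :=
  ∑ i, (u i : ℝ) • LinearMap.proj (R := ℝ) (φ := fun _ : Fin d => ℝ) i

theorem dotForm_apply (u : Fin d → ℤ) (x : Fin d → ℝ) : dotForm u x = ∑ i, (u i : ℝ) * x i := by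
  simp [dotForm]

theorem dotForm_latticeEmbedding (u a : Fin d → ℤ) :
    dotForm u (latticeEmbedding d a) = ((u ⬝ᵥ a : ℤ) : ℝ) := by
  simp [dotForm_apply, latticeEmbedding, dotProduct]

theorem dotForm_add (u v : Fin d → ℤ) (x : Fin d → ℝ) :
    dotForm (u + v) x = dotForm u x + dotForm v x := by
  simp [dotForm_apply, add_mul, Finset.sum_add_distrib]

theorem dotForm_smul (n : ℤ) (u : Fin d → ℤ) (x : Fin d → ℝ) :
    dotForm (n • u) x = n * dotForm u x := by
  simp [dotForm_apply, Finset.mul_sum, mul_assoc]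

theorem dotForm_sum {ι : Type*} (s : Finset ι) (u : ι → Fin d → ℤ) (x : Fin d → ℝ) :
    dotForm (∑ i ∈ s, u i) x = ∑ i ∈ s, dotForm (u i) x := by
  classical
  induction s using Finset.induction_on with
  | empty => simp [dotForm_apply]
  | insert a s ha ih => rw [Finset.sum_insert ha, Finset.sum_insert ha, dotForm_add, ih]

theorem continuous_dotForm (u : Fin d → ℤ) : Continuous (dotForm u) :=
  LinearMap.continuous_of_finiteDimensional _

theorem latticeEmbedding_injective : Function.Injective (latticeEmbedding d) := by
  intro a b h
  funext i
  have := congrFun h i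
  simpa [latticeEmbedding] using this

/-- Adjoining a ray to a polyhedron: one step of Fourier-Motzkin elimination. -/
theorem exists_nonneg_sub_iff (U : Finset (Fin d → ℤ)) (w : Fin d → ℤ) (x : Fin d → ℝ) :
    (∃ t : ℝ, 0 ≤ t ∧ ∀ u ∈ U, 0 ≤ dotForm u (x - t • latticeEmbedding d w)) ↔
      (∀ u ∈ U, 0 ≤ u ⬝ᵥ w → 0 ≤ dotForm u x) ∧
      ∀ u ∈ U, ∀ u' ∈ U, 0 < u ⬝ᵥ w → u' ⬝ᵥ w < 0 →
        0 ≤ dotForm ((u ⬝ᵥ w) • u' + (-(u' ⬝ᵥ w)) • u) x := by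
  classical
  have hval : ∀ (u : Fin d → ℤ) (t : ℝ), dotForm u (x - t • latticeEmbedding d w) =
      dotForm u x - t * ((u ⬝ᵥ w : ℤ) : ℝ) := by
    intro u t
    rw [map_sub, map_smul, dotForm_latticeEmbedding, smul_eq_mul]
  simp only [hval, dotForm_add, dotForm_smul]
  constructor
  · rintro ⟨t, ht, h⟩
    refine ⟨fun u hu hw => ?_, fun u hu u' hu' hw hw' => ?_⟩
    · have hw' : (0 : ℝ) ≤ ((u ⬝ᵥ w : ℤ) : ℝ) := by exact_mod_cast hw
      nlinarith [h u hu, mul_nonneg ht hw']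
    · have hw1 : (0 : ℝ) < ((u ⬝ᵥ w : ℤ) : ℝ) := by exact_mod_cast hw
      have hw2 : ((u' ⬝ᵥ w : ℤ) : ℝ) < 0 := by exact_mod_cast hw'
      push_cast
      nlinarith [mul_nonneg hw1.le (h u' hu'), mul_nonneg (neg_nonneg.2 hw2.le) (h u hu)]
  · rintro ⟨h1, h2⟩
    let S := U.filter fun u => u ⬝ᵥ w < 0
    let r : (Fin d → ℤ) → ℝ := fun u => dotForm u x / ((u ⬝ᵥ w : ℤ) : ℝ)
    -- The forms negative on `w` bound `t` from below and those positive on `w` bound it from above.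
    -- The largest lower bound, with `0` included, works, because the paired inequalities put every
    -- lower bound below every upper bound.
    obtain ⟨t, htmem, htmax⟩ := Finset.exists_max_image (insert 0 (S.image r)) id ⟨0, by simp⟩
    refine ⟨t, htmax 0 (by simp), fun u hu => ?_⟩
    rcases lt_or_ge (u ⬝ᵥ w) 0 with hneg | hnn
    · have hw2 : ((u ⬝ᵥ w : ℤ) : ℝ) < 0 := by exact_mod_cast hneg
      have := htmax (r u) (Finset.mem_insert_of_mem (Finset.mem_image_of_mem _
        (Finset.mem_filter.2 ⟨hu, hneg⟩)))
      have h3 : dotForm u x / ((u ⬝ᵥ w : ℤ) : ℝ) ≤ t := this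
      rw [div_le_iff_of_neg hw2] at h3
      linarith
    · rcases Finset.mem_insert.1 htmem with h0 | hS
      · rw [h0]; simpa using h1 u hu hnn
      · obtain ⟨u', hu', rfl⟩ := Finset.mem_image.1 hS
        obtain ⟨hu'U, hu'w⟩ := Finset.mem_filter.1 hu'
        rcases hnn.eq_or_lt with h0 | hpos
        · rw [← h0]; simpa using h1 u hu hnn
        · have h3 := h2 u hu u' hu'U hpos hu'w
          have hw2 : ((u' ⬝ᵥ w : ℤ) : ℝ) < 0 := by exact_mod_cast hu'w
          push_cast at h3
          have h4 : dotForm u x - r u' * ((u ⬝ᵥ w : ℤ) : ℝ) =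
              (((u ⬝ᵥ w : ℤ) : ℝ) * dotForm u' x + -((u' ⬝ᵥ w : ℤ) : ℝ) * dotForm u x) /
                (-((u' ⬝ᵥ w : ℤ) : ℝ)) := by
            simp only [r]
            have hw3 := hw2.ne
            field_simp
            ring
          rw [h4]
          exact div_nonneg h3 (by linarith)

/-- The Minkowski-Weyl theorem for cones generated by lattice points. -/
theorem exists_dotForm_description (T : Finset (Fin d → ℤ)) :
    ∃ U : Finset (Fin d → ℤ), ∀ x : Fin d → ℝ,
      x ∈ PointedCone.hull ℝ (latticeEmbedding d '' (T : Set (Fin d → ℤ))) ↔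
        ∀ u ∈ U, 0 ≤ dotForm u x := by
  classical
  induction T using Finset.induction_on with
  | empty =>
    refine ⟨(Finset.univ.image fun i => Pi.single i 1) ∪
      Finset.univ.image fun i => -Pi.single i 1, fun x => ?_⟩
    have h1 : ∀ i, dotForm (Pi.single i 1) x = x i := fun i => by
      simp [dotForm_apply, Pi.single_apply]
    have h2 : ∀ i, dotForm (-Pi.single i 1) x = - x i := fun i => by
      simp [dotForm_apply, Pi.single_apply]
    simp only [Finset.coe_empty, Set.image_empty, PointedCone.hull, Submodule.span_empty,
      Submodule.mem_bot, Finset.mem_union, Finset.mem_image, Finset.mem_univ, true_and]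
    constructor
    · rintro rfl u _; simp
    · intro h
      funext i
      have h3 := h _ (Or.inl ⟨i, rfl⟩)
      have h4 := h _ (Or.inr ⟨i, rfl⟩)
      rw [h1] at h3
      rw [h2] at h4
      exact le_antisymm (neg_nonneg.1 h4) h3
  | insert w T _ ih =>
    obtain ⟨U, hU⟩ := ih
    refine ⟨(U.filter fun u => 0 ≤ u ⬝ᵥ w) ∪
      ((U ×ˢ U).filter fun q => 0 < q.1 ⬝ᵥ w ∧ q.2 ⬝ᵥ w < 0).image
        (fun q => (q.1 ⬝ᵥ w) • q.2 + (-(q.2 ⬝ᵥ w)) • q.1), fun x => ?_⟩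
    have hiff := exists_nonneg_sub_iff U w x
    simp only [← hU] at hiff
    have hspan : x ∈ PointedCone.hull ℝ
        (latticeEmbedding d '' ((insert w T : Finset (Fin d → ℤ)) : Set (Fin d → ℤ))) ↔
        ∃ t : ℝ, 0 ≤ t ∧ x - t • latticeEmbedding d w ∈
          PointedCone.hull ℝ (latticeEmbedding d '' (T : Set (Fin d → ℤ))) := by
      rw [Finset.coe_insert, Set.image_insert_eq, PointedCone.hull, Submodule.mem_span_insert]
      constructor
      · rintro ⟨t, z, hz, rfl⟩
        refine ⟨t, t.2, ?_⟩
        have : (t : ℝ) • latticeEmbedding d w = t • latticeEmbedding d w := rfl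
        rw [← this, add_sub_cancel_left]
        exact hz
      · rintro ⟨t, ht, hz⟩
        refine ⟨⟨t, ht⟩, _, hz, ?_⟩
        have : (⟨t, ht⟩ : {r : ℝ // 0 ≤ r}) • latticeEmbedding d w =
          t • latticeEmbedding d w := rfl
        rw [this, add_sub_cancel]
    rw [hspan, hiff]
    constructor
    · rintro ⟨h1, h2⟩ u hu
      rcases Finset.mem_union.1 hu with hu | hu
      · exact h1 u (Finset.mem_filter.1 hu).1 (Finset.mem_filter.1 hu).2
      · obtain ⟨q, hq, rfl⟩ := Finset.mem_image.1 hu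
        obtain ⟨hq1, hq2, hq3⟩ := Finset.mem_filter.1 hq
        exact h2 _ (Finset.mem_product.1 hq1).1 _ (Finset.mem_product.1 hq1).2 hq2 hq3
    · intro h
      refine ⟨fun u hu hw => h u (Finset.mem_union_left _ (Finset.mem_filter.2 ⟨hu, hw⟩)),
        fun u hu u' hu' hw hw' => h _ (Finset.mem_union_right _ (Finset.mem_image.2
          ⟨(u, u'), Finset.mem_filter.2 ⟨Finset.mem_product.2 ⟨hu, hu'⟩, hw, hw'⟩, rfl⟩))⟩

/-- Nonzero lattice generators of a cone, together with nonzero integral inequalities that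
define it. -/
structure ConePresentation (σ : PointedCone ℝ (Fin d → ℝ)) where
  /-- The generators. -/
  gens : Finset (Fin d → ℤ)
  /-- The inequalities. -/
  ineqs : Finset (Fin d → ℤ)
  gens_ne_zero : ∀ w ∈ gens, w ≠ 0
  ineqs_ne_zero : ∀ u ∈ ineqs, u ≠ 0
  mem_iff_gens : ∀ x, x ∈ σ ↔ ∃ c : (Fin d → ℤ) → ℝ,
    (∀ w, 0 ≤ c w) ∧ ∑ w ∈ gens, c w • latticeEmbedding d w = x
  mem_iff_ineqs : ∀ x, x ∈ σ ↔ ∀ u ∈ ineqs, 0 ≤ dotForm u x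

theorem IsRationalPolyhedralCone.nonempty_presentation {σ : PointedCone ℝ (Fin d → ℝ)}
    (hσ : IsRationalPolyhedralCone σ) : Nonempty (ConePresentation σ) := by
  classical
  obtain ⟨T, rfl⟩ := hσ
  obtain ⟨U, hU⟩ := exists_dotForm_description T
  -- Dropping zero vectors matters later: a nonzero generator is a genuine direction of translation,
  -- and a nonzero inequality is strictly positive somewhere on a full-dimensional cone.
  refine ⟨⟨T.erase 0, U.erase 0, fun w hw => Finset.ne_of_mem_erase hw,
    fun u hu => Finset.ne_of_mem_erase hu, fun x => ?_, fun x => ?_⟩⟩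
  · rw [PointedCone.hull, Submodule.mem_span_image_finset_iff_exists_fun']
    constructor
    · rintro ⟨c, rfl⟩
      refine ⟨fun w => c w, fun w => (c w).2, ?_⟩
      rw [Finset.sum_erase _ (by simp)]
      rfl
    · rintro ⟨c, hc, rfl⟩
      refine ⟨fun w => ⟨c w, hc w⟩, ?_⟩
      rw [Finset.sum_erase _ (by simp)]
      rfl
  · rw [hU]
    refine ⟨fun h u hu => h u (Finset.mem_of_mem_erase hu), fun h u hu => ?_⟩
    by_cases h0 : u = 0
    · subst h0; simp [dotForm_apply]
    · exact h u (Finset.mem_erase.2 ⟨h0, hu⟩)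

namespace ConePresentation

variable {σ : PointedCone ℝ (Fin d → ℝ)} (P : ConePresentation σ)
include P

theorem gens_mem {w : Fin d → ℤ} (hw : w ∈ P.gens) : latticeEmbedding d w ∈ σ := by
  classical
  refine (P.mem_iff_gens _).2 ⟨fun v => if v = w then 1 else 0, fun v => by positivity, ?_⟩
  simp [hw]

theorem dotProduct_nonneg {w u : Fin d → ℤ} (hw : w ∈ P.gens) (hu : u ∈ P.ineqs) :
    0 ≤ u ⬝ᵥ w := by
  have := (P.mem_iff_ineqs _).1 (P.gens_mem hw) u hu
  rw [dotForm_latticeEmbedding] at this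
  exact_mod_cast this

theorem sum_mem {c : (Fin d → ℤ) → ℝ} (hc : ∀ w, 0 ≤ c w) :
    ∑ w ∈ P.gens, c w • latticeEmbedding d w ∈ σ :=
  (P.mem_iff_gens _).2 ⟨c, hc, rfl⟩

/-- A form of `P.ineqs` that vanished on the sum of the generators would vanish on each of them,
hence on the whole space. The sum thus serves as an interior point of `σ`. -/
theorem dotForm_sum_pos (hfull : Submodule.span ℝ (σ : Set (Fin d → ℝ)) = ⊤) {u : Fin d → ℤ}
    (hu : u ∈ P.ineqs) : 0 < dotForm u (∑ w ∈ P.gens, latticeEmbedding d w) := by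
  rw [map_sum]
  have hnn : ∀ w ∈ P.gens, 0 ≤ dotForm u (latticeEmbedding d w) := fun w hw =>
    (P.mem_iff_ineqs _).1 (P.gens_mem hw) u hu
  refine lt_of_le_of_ne (Finset.sum_nonneg hnn) fun h0 => P.ineqs_ne_zero u hu ?_
  have hz := (Finset.sum_eq_zero_iff_of_nonneg hnn).1 h0.symm
  have hle : Submodule.span ℝ (σ : Set (Fin d → ℝ)) ≤ LinearMap.ker (dotForm u) := by
    refine Submodule.span_le.2 fun x hx => ?_
    obtain ⟨c, -, rfl⟩ := (P.mem_iff_gens x).1 hx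
    rw [SetLike.mem_coe, LinearMap.mem_ker, map_sum]
    exact Finset.sum_eq_zero fun w hw => by rw [map_smul, hz w hw, smul_zero]
  rw [hfull, top_le_iff, LinearMap.ker_eq_top] at hle
  funext i
  have := congrArg (fun f => f (Pi.single i 1)) hle
  simpa [dotForm_apply, Pi.single_apply] using this

theorem mem_translatedCone {v x : Fin d → ℝ} :
    x ∈ translatedCone σ v ↔ ∀ u ∈ P.ineqs, dotForm u v ≤ dotForm u x := by
  have : x ∈ translatedCone σ v ↔ x - v ∈ σ := by
    constructor
    · rintro ⟨y, hy, rfl⟩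
      simpa using hy
    · intro h
      exact ⟨x - v, h, by simp⟩
  rw [this, P.mem_iff_ineqs]
  simp only [map_sub, sub_nonneg]

theorem mem_coneUnion {s : ℕ} {m : Fin s → coneMonoid σ} {x : Fin d → ℝ} :
    x ∈ coneUnion m ↔ ∃ i, ∀ u ∈ P.ineqs, dotForm u (conePoint (m i)) ≤ dotForm u x := by
  simp only [coneUnion, Set.mem_iUnion, P.mem_translatedCone]

theorem add_mem_coneUnion {s : ℕ} {m : Fin s → coneMonoid σ} {x y : Fin d → ℝ}
    (hx : x ∈ coneUnion m) (hy : y ∈ σ) : x + y ∈ coneUnion m := by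
  obtain ⟨i, hi⟩ := P.mem_coneUnion.1 hx
  refine P.mem_coneUnion.2 ⟨i, fun u hu => ?_⟩
  rw [map_add]
  linarith [hi u hu, (P.mem_iff_ineqs y).1 hy u hu]

end ConePresentation

/-! ### Finite volume, rays entering `W_I`, and linear inequalities for `LC_I` -/

theorem volume_eq_top_of_translate {O : Set (Fin d → ℝ)} (hO : IsOpen O) (hne : O.Nonempty)
    {w : Fin d → ℝ} (hw : w ≠ 0) (htr : ∀ x ∈ O, ∀ n : ℕ, x + (n : ℝ) • w ∈ O) :
    volume O = ∞ := by
  obtain ⟨x, hx⟩ := hne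
  obtain ⟨r, hr, hball⟩ := Metric.isOpen_iff.1 hO x hx
  have hw' : 0 < ‖w‖ := norm_pos_iff.2 hw
  -- Translating a ball of radius `r` by multiples of `N w` gives pairwise disjoint balls as soon as
  -- `N ‖w‖ > 2 r`; infinitely many of them, of equal positive volume, lie in `O`.
  obtain ⟨N, hN⟩ := exists_nat_gt (2 * r / ‖w‖)
  have hN' : 2 * r < N * ‖w‖ := (div_lt_iff₀ hw').1 hN
  let B : ℕ → Set (Fin d → ℝ) := fun n => Metric.ball (x + ((n * N : ℕ) : ℝ) • w) r
  have hsub : ⋃ n, B n ⊆ O := by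
    refine Set.iUnion_subset fun n y hy => ?_
    have h1 : y - ((n * N : ℕ) : ℝ) • w ∈ O := hball (by
      rw [Metric.mem_ball, dist_eq_norm] at *
      convert hy using 2
      module)
    have := htr _ h1 (n * N)
    rwa [sub_add_cancel] at this
  have hdisj : Pairwise (Function.onFun Disjoint B) := by
    intro a b hab
    refine Set.disjoint_left.2 fun y hya hyb => ?_
    have h1 : dist (x + ((a * N : ℕ) : ℝ) • w) (x + ((b * N : ℕ) : ℝ) • w) < r + r :=
      (dist_triangle_left _ _ y).trans_lt (add_lt_add hya hyb)
    rw [dist_add_left, dist_eq_norm, ← sub_smul, norm_smul] at h1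
    have h2 : (N : ℝ) ≤ ‖((a * N : ℕ) : ℝ) - ((b * N : ℕ) : ℝ)‖ := by
      push_cast
      rw [← sub_mul, norm_mul, Real.norm_natCast]
      have : (1 : ℝ) ≤ ‖(a : ℝ) - b‖ := by
        have h3 : (1 : ℤ) ≤ |(a : ℤ) - b| := Int.one_le_abs (sub_ne_zero.2 (by exact_mod_cast hab))
        rw [Real.norm_eq_abs]
        exact_mod_cast h3
      nlinarith [(N.cast_nonneg : (0 : ℝ) ≤ N)]
    nlinarith [mul_le_mul_of_nonneg_right h2 hw'.le]
  have hvol : ∀ n, volume (B n) = volume (Metric.ball (0 : Fin d → ℝ) r) := fun n =>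
    Measure.addHaar_ball_center _ _ _
  refine top_le_iff.1 (le_trans (le_of_eq ?_) (measure_mono hsub))
  rw [measure_iUnion hdisj fun n => Metric.isOpen_ball.measurableSet]
  simp_rw [hvol]
  exact (ENNReal.tsum_const_eq_top_of_ne_zero (Metric.measure_ball_pos volume _ hr).ne').symm

namespace ConePresentation

variable {σ : PointedCone ℝ (Fin d → ℝ)} (P : ConePresentation σ)
include P

theorem isBounded_image_sum (v : Fin d → ℝ) (K : (Fin d → ℤ) → ℝ) :
    Bornology.IsBounded {x | ∃ c : (Fin d → ℤ) → ℝ, (∀ w ∈ P.gens, 0 ≤ c w ∧ c w ≤ K w) ∧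
      v + ∑ w ∈ P.gens, c w • latticeEmbedding d w = x} := by
  refine (Metric.isBounded_iff_subset_closedBall 0).2
    ⟨‖v‖ + ∑ w ∈ P.gens, K w * ‖latticeEmbedding d w‖, ?_⟩
  rintro _ ⟨c, hc, rfl⟩
  rw [mem_closedBall_zero_iff]
  refine (norm_add_le _ _).trans (add_le_add le_rfl ((norm_sum_le _ _).trans
    (Finset.sum_le_sum fun w hw => ?_)))
  rw [norm_smul, Real.norm_eq_abs, abs_of_nonneg (hc w hw).1]
  exact mul_le_mul_of_nonneg_right (hc w hw).2 (norm_nonneg _)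

/-- In every direction of a generator, `v` eventually enters `W`. -/
def EntersUnion {s : ℕ} (m : Fin s → coneMonoid σ) (v : Fin d → ℝ) : Prop :=
  ∀ w ∈ P.gens, ∃ N : ℕ, v + (N : ℝ) • latticeEmbedding d w ∈ coneUnion m

/-- The linear inequalities that describe the locus `LC`. -/
def LocusIneqs {s : ℕ} (m : Fin s → coneMonoid σ) (v : Fin d → ℝ) : Prop :=
  ∀ w ∈ P.gens, ∃ i, ∀ u ∈ P.ineqs, u ⬝ᵥ w = 0 → dotForm u (conePoint (m i)) ≤ dotForm u v

/-- If the inequalities fail for a generator `w`, each `mᵢ` has a form `f i` that vanishes on `w`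
and satisfies `f i (v) < f i (mᵢ)`. The points interior to `v + σ` where all these strict
inequalities persist form a nonempty open set that avoids `W_I` and is stable under adding `w`, so
its volume is infinite. -/
theorem locusIneqs_of_volume (hfull : Submodule.span ℝ (σ : Set (Fin d → ℝ)) = ⊤)
    {s : ℕ} {m : Fin s → coneMonoid σ} {v : Fin d → ℝ} (hv : v ∈ finiteColengthLocus m) :
    P.LocusIneqs m v := by
  classical
  by_contra hcon
  simp only [LocusIneqs, not_forall, not_exists, not_le] at hcon
  obtain ⟨w, hw, hcon⟩ := hcon
  choose f hf hfw hfv using hcon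
  set z : Fin d → ℝ := ∑ w ∈ P.gens, latticeEmbedding d w
  let O : Set (Fin d → ℝ) := (⋂ u ∈ P.ineqs, {y | dotForm u v < dotForm u y}) ∩
    ⋂ i, {y | dotForm (f i) y < dotForm (f i) (conePoint (m i))}
  have hO : IsOpen O := by
    refine IsOpen.inter ?_ ?_
    · exact isOpen_biInter_finset fun u _ => isOpen_lt continuous_const (continuous_dotForm u)
    · exact isOpen_iInter_of_finite fun i => isOpen_lt (continuous_dotForm _) continuous_const
  have hmem : ∀ y, y ∈ O ↔ (∀ u ∈ P.ineqs, dotForm u v < dotForm u y) ∧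
      ∀ i, dotForm (f i) y < dotForm (f i) (conePoint (m i)) := by
    intro y
    simp [O]
  have hne : O.Nonempty := by
    have hcont : ∀ i, ContinuousAt (fun ε : ℝ => dotForm (f i) (v + ε • z)) 0 := fun i =>
      ((continuous_dotForm (f i)).comp (by fun_prop)).continuousAt
    have hev : ∀ᶠ ε in 𝓝[>] (0 : ℝ),
        ∀ i, dotForm (f i) (v + ε • z) < dotForm (f i) (conePoint (m i)) := by
      refine Filter.Eventually.filter_mono nhdsWithin_le_nhds (Filter.eventually_all.2 fun i => ?_)
      exact (hcont i).eventually_lt continuousAt_const (by simpa using hfv i)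
    obtain ⟨ε, hε, hpos⟩ := (hev.and self_mem_nhdsWithin).exists
    refine ⟨v + ε • z, (hmem _).2 ⟨fun u hu => ?_, hε⟩⟩
    rw [map_add, map_smul, smul_eq_mul]
    have := mul_pos (Set.mem_Ioi.1 hpos) (P.dotForm_sum_pos hfull hu)
    linarith
  have htr : ∀ x ∈ O, ∀ n : ℕ, x + (n : ℝ) • latticeEmbedding d w ∈ O := by
    intro x hx n
    rw [hmem] at hx ⊢
    refine ⟨fun u hu => ?_, fun i => ?_⟩
    · rw [map_add, map_smul, dotForm_latticeEmbedding, smul_eq_mul]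
      have h1 : (0 : ℝ) ≤ ((u ⬝ᵥ w : ℤ) : ℝ) := by exact_mod_cast P.dotProduct_nonneg hw hu
      have h2 := mul_nonneg (n.cast_nonneg : (0 : ℝ) ≤ n) h1
      linarith [hx.1 u hu]
    · rw [map_add, map_smul, dotForm_latticeEmbedding, hfw i]
      simpa using hx.2 i
  have htop := volume_eq_top_of_translate hO hne
    (fun h0 => P.gens_ne_zero w hw (latticeEmbedding_injective (h0.trans (map_zero _).symm))) htr
  have hsub : O ⊆ translatedCone σ v \ (translatedCone σ v ∩ coneUnion m) := by
    intro y hy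
    rw [hmem] at hy
    refine ⟨P.mem_translatedCone.2 fun u hu => (hy.1 u hu).le, fun h => ?_⟩
    obtain ⟨i, hi⟩ := P.mem_coneUnion.1 h.2
    exact absurd (hi (f i) (hf i)) (not_le.2 (hy.2 i))
  have hlt : volume (translatedCone σ v \ (translatedCone σ v ∩ coneUnion m)) < ∞ := hv
  exact absurd (htop ▸ measure_mono hsub) (not_le.2 hlt)

/-- Along `w` the forms with `⟨u, w⟩ > 0` grow without bound, while those with `⟨u, w⟩ = 0` stay
constant and already satisfy their inequality. -/
theorem entersUnion_of_locusIneqs {s : ℕ} {m : Fin s → coneMonoid σ} {v : Fin d → ℝ}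
    (hv : P.LocusIneqs m v) : P.EntersUnion m v := by
  intro w hw
  obtain ⟨i, hi⟩ := hv w hw
  have hev : ∀ᶠ N : ℕ in atTop, ∀ u ∈ P.ineqs,
      dotForm u (conePoint (m i)) ≤ dotForm u (v + (N : ℝ) • latticeEmbedding d w) := by
    rw [Filter.eventually_all_finset]
    intro u hu
    simp only [map_add, map_smul, dotForm_latticeEmbedding, smul_eq_mul]
    rcases (P.dotProduct_nonneg hw hu).eq_or_lt with h0 | hpos
    · refine Filter.Eventually.of_forall fun N => ?_
      rw [← h0]
      simpa using hi u hu h0.symm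
    · have hpos' : (0 : ℝ) < ((u ⬝ᵥ w : ℤ) : ℝ) := by exact_mod_cast hpos
      exact (tendsto_atTop_add_const_left _ (dotForm u v)
        (tendsto_natCast_atTop_atTop.atTop_mul_const hpos')).eventually_ge_atTop _
  obtain ⟨N, hN⟩ := hev.exists
  exact ⟨N, P.mem_coneUnion.2 ⟨i, hN⟩⟩

theorem mem_coneUnion_of_le {s : ℕ} {m : Fin s → coneMonoid σ} {v : Fin d → ℝ} {w : Fin d → ℤ}
    {t : ℝ} (h : v + t • latticeEmbedding d w ∈ coneUnion m) (hw : w ∈ P.gens)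
    {c : (Fin d → ℤ) → ℝ} (hc : ∀ w, 0 ≤ c w) (ht : t ≤ c w) :
    v + ∑ w ∈ P.gens, c w • latticeEmbedding d w ∈ coneUnion m := by
  classical
  have hmem : ∑ x ∈ P.gens, (if x = w then c w - t else c x) • latticeEmbedding d x ∈ σ :=
    P.sum_mem (c := fun x => if x = w then c w - t else c x) fun x => by
      by_cases hx : x = w
      · simp [hx, ht]
      · simp [hx, hc x]
  convert P.add_mem_coneUnion h hmem using 1
  rw [add_assoc, ← Finset.add_sum_erase _ _ hw, ← Finset.add_sum_erase _ _ hw, if_pos rfl,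
    ← add_assoc (t • _), ← add_smul, add_sub_cancel]
  congr 2
  exact Finset.sum_congr rfl fun x hx => by rw [if_neg (Finset.ne_of_mem_erase hx)]

/-- `W_I` is stable under adding `σ`, so a point `v + ∑ c_w w` outside `W_I` has every `c_w` below
the entry time `N w`. The difference is therefore bounded. -/
theorem mem_locus_of_entersUnion {s : ℕ} {m : Fin s → coneMonoid σ} {v : Fin d → ℝ}
    (hv : P.EntersUnion m v) : v ∈ finiteColengthLocus m := by
  choose! N hN using hv
  refine (Bornology.IsBounded.subset (P.isBounded_image_sum v fun w => N w) ?_).measure_lt_top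
  rintro _ ⟨⟨y, hy, rfl⟩, hnot⟩
  obtain ⟨c, hc, rfl⟩ := (P.mem_iff_gens y).1 hy
  refine ⟨c, fun w hw => ⟨hc w, ?_⟩, rfl⟩
  by_contra hlt
  exact hnot ⟨⟨_, hy, rfl⟩, P.mem_coneUnion_of_le (hN w hw) hw hc (not_le.1 hlt).le⟩

theorem mem_locus_iff_locusIneqs (hfull : Submodule.span ℝ (σ : Set (Fin d → ℝ)) = ⊤)
    {s : ℕ} {m : Fin s → coneMonoid σ} {v : Fin d → ℝ} :
    v ∈ finiteColengthLocus m ↔ P.LocusIneqs m v :=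
  ⟨P.locusIneqs_of_volume hfull,
    fun h => P.mem_locus_of_entersUnion (P.entersUnion_of_locusIneqs h)⟩

theorem mem_locus_iff_entersUnion (hfull : Submodule.span ℝ (σ : Set (Fin d → ℝ)) = ⊤)
    {s : ℕ} {m : Fin s → coneMonoid σ} {v : Fin d → ℝ} :
    v ∈ finiteColengthLocus m ↔ P.EntersUnion m v :=
  ⟨fun h => P.entersUnion_of_locusIneqs (P.locusIneqs_of_volume hfull h),
    P.mem_locus_of_entersUnion⟩

theorem exists_gen_notMem_span (hfull : Submodule.span ℝ (σ : Set (Fin d → ℝ)) = ⊤)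
    (hd : 1 < d) (v : Fin d → ℝ) :
    ∃ w ∈ P.gens, latticeEmbedding d w ∉ Submodule.span ℝ {v} := by
  by_contra hcon
  push Not at hcon
  have hle : Submodule.span ℝ (σ : Set (Fin d → ℝ)) ≤ Submodule.span ℝ {v} := by
    refine Submodule.span_le.2 fun x hx => ?_
    obtain ⟨c, -, rfl⟩ := (P.mem_iff_gens x).1 hx
    exact Submodule.sum_mem _ fun w hw => Submodule.smul_mem _ _ (hcon w hw)
  have h1 := Submodule.finrank_mono hle
  rw [hfull, finrank_top, Module.finrank_fin_fun] at h1
  have h2 : Module.finrank ℝ (Submodule.span ℝ ({v} : Set (Fin d → ℝ))) ≤ 1 := by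
    simpa using finrank_span_le_card (R := ℝ) ({v} : Set (Fin d → ℝ))
  omega

/-- Let `v ∉ σ`, and move from `v` towards a generator `x` that is not proportional to `v`; such an
`x` needs `d > 1`. The first point `y` of `σ` is nonzero and lies on a face `u = 0` with `u(v) < 0`.
A generator `w'` occurring in `y` lies on that face, so `LocusIneqs` at `w'` gives `u(mᵢ) ≤ u(v) <
0`, against `mᵢ ∈ σ`. -/
theorem locus_subset (hfull : Submodule.span ℝ (σ : Set (Fin d → ℝ)) = ⊤) (hd : d ≠ 1)
    {s : ℕ} {m : Fin s → coneMonoid σ} :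
    finiteColengthLocus m ⊆ (σ : Set (Fin d → ℝ)) := by
  classical
  intro v hv
  rcases Nat.eq_zero_or_pos d with hd0 | hd0
  · subst hd0
    rw [Subsingleton.elim v 0]
    exact σ.zero_mem
  by_contra hvσ
  obtain ⟨w, hw, hwv⟩ := P.exists_gen_notMem_span hfull (by omega) v
  have hL := P.locusIneqs_of_volume hfull hv
  set x := latticeEmbedding d w
  have hxσ : x ∈ σ := P.gens_mem hw
  have hx : ∀ u ∈ P.ineqs, 0 ≤ dotForm u x := (P.mem_iff_ineqs x).1 hxσ
  have hex : ∃ u ∈ P.ineqs, dotForm u v < 0 := by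
    by_contra h
    push Not at h
    exact hvσ ((P.mem_iff_ineqs v).2 h)
  let S := P.ineqs.filter fun u => dotForm u v < 0
  -- The parameter at which `u` vanishes on the segment from `v` to `x`. The maximum over the forms
  -- negative at `v` is the moment of entry into `σ`.
  let r : (Fin d → ℤ) → ℝ := fun u => -dotForm u v / (dotForm u x - dotForm u v)
  obtain ⟨u, huS, hmax⟩ := Finset.exists_max_image S r (by
    obtain ⟨u, hu, h⟩ := hex
    exact ⟨u, Finset.mem_filter.2 ⟨hu, h⟩⟩)
  obtain ⟨hu, huv⟩ := Finset.mem_filter.1 huS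
  have hpos : 0 < dotForm u x - dotForm u v := by linarith [hx u hu]
  have ht0 : 0 < r u := div_pos (by linarith) hpos
  have ht1 : r u ≤ 1 := (div_le_one hpos).2 (by linarith [hx u hu])
  set y : Fin d → ℝ := (1 - r u) • v + r u • x
  have hyval : ∀ u', dotForm u' y = (1 - r u) * dotForm u' v + r u * dotForm u' x := fun u' => by
    simp [y]
  have hyσ : y ∈ σ := by
    refine (P.mem_iff_ineqs y).2 fun u' hu' => ?_
    rw [hyval]
    rcases lt_or_ge (dotForm u' v) 0 with h | h
    · have h1 := hmax u' (Finset.mem_filter.2 ⟨hu', h⟩)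
      have hpos' : 0 < dotForm u' x - dotForm u' v := by linarith [hx u' hu']
      have h2 : -dotForm u' v ≤ r u * (dotForm u' x - dotForm u' v) :=
        (div_le_iff₀ hpos').1 h1
      nlinarith
    · have := mul_nonneg (sub_nonneg.2 ht1) h
      have := mul_nonneg ht0.le (hx u' hu')
      linarith
  have hyu : dotForm u y = 0 := by
    rw [hyval]
    have : r u * (dotForm u x - dotForm u v) = -dotForm u v := div_mul_cancel₀ _ hpos.ne'
    linarith
  obtain ⟨c, hc, hcy⟩ := (P.mem_iff_gens y).1 hyσ
  by_cases hall : ∀ w' ∈ P.gens, c w' = 0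
  · have hy0 : y = 0 := by
      rw [← hcy]
      exact Finset.sum_eq_zero fun w' hw' => by rw [hall w' hw', zero_smul]
    refine hwv (Submodule.mem_span_singleton.2 ⟨-((1 - r u) / r u), ?_⟩)
    have h3 : r u • x = -((1 - r u) • v) := by
      rw [eq_neg_iff_add_eq_zero, add_comm]; exact hy0
    rw [← inv_smul_smul₀ ht0.ne' x, h3, smul_neg, smul_smul, neg_smul, div_eq_inv_mul]
  · push Not at hall
    obtain ⟨w', hw', hcw'⟩ := hall
    have hzero : u ⬝ᵥ w' = 0 := by
      rw [← hcy, map_sum] at hyu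
      have h4 := (Finset.sum_eq_zero_iff_of_nonneg fun w'' hw'' => by
        rw [map_smul, smul_eq_mul]
        exact mul_nonneg (hc w'') ((P.mem_iff_ineqs _).1 (P.gens_mem hw'') u hu)).1 hyu w' hw'
      rw [map_smul, smul_eq_mul, dotForm_latticeEmbedding] at h4
      exact_mod_cast (mul_eq_zero.1 h4).resolve_left hcw'
    obtain ⟨i, hi⟩ := hL w' hw'
    have h5 := hi u hu hzero
    have h6 := (P.mem_iff_ineqs _).1 (m i).2 u hu
    have h7 : 0 ≤ dotForm u (conePoint (m i)) := h6
    linarith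

/-- Write a point of `LC_I ∩ σ` as `∑ c_w w`. If some `c_w` exceeds a uniform bound `K`, the forms
positive on `w` are large, since the other generators contribute nonnegatively, and the forms
vanishing on `w` are controlled by `LocusIneqs`. Then the point lies in `W_I`. -/
theorem isBounded_locus_diff (hfull : Submodule.span ℝ (σ : Set (Fin d → ℝ)) = ⊤)
    {s : ℕ} (m : Fin s → coneMonoid σ) :
    Bornology.IsBounded ((finiteColengthLocus m ∩ (σ : Set (Fin d → ℝ))) \ coneUnion m) := by
  have hev : ∀ᶠ K : ℝ in atTop, ∀ w ∈ P.gens, ∀ u ∈ P.ineqs, ∀ i, u ⬝ᵥ w ≠ 0 →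
      dotForm u (conePoint (m i)) ≤ K * ((u ⬝ᵥ w : ℤ) : ℝ) := by
    simp only [Filter.eventually_all_finset, Filter.eventually_all]
    intro w hw u hu i h0
    have hpos : (0 : ℝ) < ((u ⬝ᵥ w : ℤ) : ℝ) := by
      exact_mod_cast lt_of_le_of_ne (P.dotProduct_nonneg hw hu) (Ne.symm h0)
    exact (tendsto_id.atTop_mul_const hpos).eventually_ge_atTop _
  obtain ⟨K, hK⟩ := hev.exists
  refine (P.isBounded_image_sum 0 fun _ => K).subset ?_
  rintro y ⟨⟨hyL, hyσ⟩, hyW⟩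
  obtain ⟨c, hc, rfl⟩ := (P.mem_iff_gens y).1 hyσ
  refine ⟨c, fun w hw => ⟨hc w, ?_⟩, zero_add _⟩
  by_contra hlt
  obtain ⟨i, hi⟩ := P.locusIneqs_of_volume hfull hyL w hw
  refine hyW (P.mem_coneUnion.2 ⟨i, fun u hu => ?_⟩)
  by_cases h0 : u ⬝ᵥ w = 0
  · exact hi u hu h0
  · have hnn : ∀ w' ∈ P.gens, 0 ≤ c w' * ((u ⬝ᵥ w' : ℤ) : ℝ) := fun w' hw' =>
      mul_nonneg (hc w') (by exact_mod_cast P.dotProduct_nonneg hw' hu)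
    calc dotForm u (conePoint (m i)) ≤ K * ((u ⬝ᵥ w : ℤ) : ℝ) := hK w hw u hu i h0
      _ ≤ c w * ((u ⬝ᵥ w : ℤ) : ℝ) := mul_le_mul_of_nonneg_right (not_le.1 hlt).le
          (by exact_mod_cast P.dotProduct_nonneg hw hu)
      _ ≤ ∑ w' ∈ P.gens, c w' * ((u ⬝ᵥ w' : ℤ) : ℝ) := Finset.single_le_sum hnn hw
      _ = dotForm u (∑ w' ∈ P.gens, c w' • latticeEmbedding d w') := by
          simp only [map_sum, map_smul, dotForm_latticeEmbedding, smul_eq_mul]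

/-- By `LocusIneqs`, membership in `LC_I`, like membership in `σ` and `W_I`, is a Boolean
combination of the inequalities `⟨u, x⟩ ≥ 0` and `⟨u, x⟩ ≥ ⟨u, mᵢ⟩`, whose constants are integers.
-/
theorem exists_isDeterminedBy (hfull : Submodule.span ℝ (σ : Set (Fin d → ℝ)) = ⊤)
    {s : ℕ} (m : Fin s → coneMonoid σ) :
    ∃ H : Finset ((Fin d → ℤ) × ℤ), IsDeterminedBy H
      ((finiteColengthLocus m ∩ (σ : Set (Fin d → ℝ))) \ coneUnion m) := by
  classical
  refine ⟨P.ineqs ×ˢ {0} ∪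
    (P.ineqs ×ˢ Finset.univ).image fun q => (q.1, q.1 ⬝ᵥ (m q.2 : Fin d → ℤ)), ?_⟩
  intro x y h hx
  have hval : ∀ (u : Fin d → ℤ) (c : ℤ) (z : Fin d → ℝ),
      0 ≤ affineForm (u, c) z ↔ (c : ℝ) ≤ dotForm u z := by
    intro u c z
    rw [affineForm_apply, dotForm_apply, sub_nonneg]
  have h0 : ∀ u ∈ P.ineqs, (0 ≤ dotForm u x ↔ 0 ≤ dotForm u y) := by
    intro u hu
    have := h (u, 0) (Finset.mem_union_left _ (by simp [hu]))
    rw [hval, hval] at this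
    simpa using this
  have hm : ∀ u ∈ P.ineqs, ∀ i, (dotForm u (conePoint (m i)) ≤ dotForm u x ↔
      dotForm u (conePoint (m i)) ≤ dotForm u y) := by
    intro u hu i
    have := h (u, u ⬝ᵥ (m i : Fin d → ℤ)) (Finset.mem_union_right _
      (Finset.mem_image.2 ⟨(u, i), by simp [hu], rfl⟩))
    rw [hval, hval, ← dotForm_latticeEmbedding] at this
    exact this
  refine ⟨⟨?_, ?_⟩, ?_⟩
  · rw [P.mem_locus_iff_locusIneqs hfull]
    intro w hw
    obtain ⟨i, hi⟩ := P.locusIneqs_of_volume hfull hx.1.1 w hw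
    exact ⟨i, fun u hu h1 => (hm u hu i).1 (hi u hu h1)⟩
  · exact (P.mem_iff_ineqs y).2 fun u hu => (h0 u hu).1 ((P.mem_iff_ineqs x).1 hx.1.2 u hu)
  · intro hy
    obtain ⟨i, hi⟩ := P.mem_coneUnion.1 hy
    exact hx.2 (P.mem_coneUnion.2 ⟨i, fun u hu => (hm u hu i).2 (hi u hu)⟩)

end ConePresentation

/-! ### Counting lattice points -/

open scoped Pointwise in
theorem card_inter_inv_smul_lattice (s : Set (Fin d → ℝ)) {q : ℕ} (hq : 0 < q) :
    Nat.card ↑(s ∩ (q : ℝ)⁻¹ • (Submodule.span ℤ (Set.range (Pi.basisFun ℝ (Fin d))) :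
      Set (Fin d → ℝ))) =
    Nat.card {a : Fin d → ℤ // (q : ℝ)⁻¹ • latticeEmbedding d a ∈ s} := by
  have : NeZero q := ⟨hq.ne'⟩
  have hq' : (q : ℝ) ≠ 0 := by exact_mod_cast hq.ne'
  have hmem : ∀ a : Fin d → ℤ, (q : ℝ)⁻¹ • latticeEmbedding d a ∈
      (q : ℝ)⁻¹ • (Submodule.span ℤ (Set.range (Pi.basisFun ℝ (Fin d))) : Set (Fin d → ℝ)) := by
    refine fun a => (BoxIntegral.unitPartition.mem_smul_span_iff (n := q)).2 fun i => ⟨a i, ?_⟩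
    simp [latticeEmbedding, hq']
  refine (Nat.card_congr (Equiv.ofBijective (fun a => ⟨(q : ℝ)⁻¹ • latticeEmbedding d a.1,
    a.2, hmem a.1⟩) ⟨fun a b hab => ?_, ?_⟩)).symm
  · have := congrArg Subtype.val hab
    exact Subtype.ext (latticeEmbedding_injective (smul_right_injective _ (inv_ne_zero hq') this))
  · rintro ⟨x, hx, hxL⟩
    choose a ha using (BoxIntegral.unitPartition.mem_smul_span_iff (n := q)).1 hxL
    have hxa : (q : ℝ)⁻¹ • latticeEmbedding d a = x := by
      funext i
      have := ha i
      simp only [eq_intCast] at this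
      simp [latticeEmbedding, this, hq']
    exact ⟨⟨a, hxa ▸ hx⟩, Subtype.ext hxa⟩

theorem IsDeterminedBy.tendsto_card {H : Finset ((Fin d → ℤ) × ℤ)} {E : Set (Fin d → ℝ)}
    (hE : IsDeterminedBy H E) (hb : Bornology.IsBounded E) :
    Tendsto (fun q : ℕ =>
      (Nat.card {a : Fin d → ℤ // (q : ℝ)⁻¹ • latticeEmbedding d a ∈ E} : ℝ) / (q : ℝ) ^ d)
      atTop (𝓝 (volume.real E)) := by
  have := tendsto_card_div_pow_atTop_volume E hb hE.measurableSet hE.volume_frontier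
  refine this.congr' ?_
  filter_upwards [eventually_gt_atTop 0] with q hq
  rw [card_inter_inv_smul_lattice E hq, Fintype.card_fin]

end ConeGeometry

/-! ### Length and local cohomology -/

section Length

/-- If `k` maps onto the residue field of `𝔪`, the length of a finite-dimensional `𝔪`-power
torsion module is its dimension over `k`. -/
theorem Module.length_eq_finrank_of_forall_exists_pow_smul (k : Type*) {A : Type*} [Field k]
    [CommRing A] [Algebra k A] (𝔪 : Ideal A) (hres : ∀ a : A, ∃ c : k, a - algebraMap k A c ∈ 𝔪)
    (N : Type*) [AddCommGroup N] [Module A N] [Module k N] [IsScalarTower k A N]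
    [Module.Finite k N] (htors : ∀ x : N, ∃ t : ℕ, ∀ a ∈ 𝔪 ^ t, a • x = 0) :
    Module.length A N = Module.finrank k N := by
  induction hn : Module.finrank k N using Nat.strong_induction_on generalizing N with
  | _ n ih =>
    classical
    rcases subsingleton_or_nontrivial N with hN | hN
    · rw [Module.length_eq_zero, ← hn, Module.finrank_zero_of_subsingleton]
      rfl
    obtain ⟨x, hx⟩ := exists_ne (0 : N)
    -- A socle element: if `t + 1` is the least power of `𝔪` killing `x`, any nonzero multiple of
    -- `x` by an element of `𝔪 ^ t` is killed by `𝔪`.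
    obtain ⟨y, hy, hmy⟩ : ∃ y : N, y ≠ 0 ∧ ∀ a ∈ 𝔪, a • y = 0 := by
      have hspec := Nat.find_spec (htors x)
      have hmin := fun t => Nat.find_min (htors x) (m := t)
      rcases ht : Nat.find (htors x) with _ | t
      · rw [ht, pow_zero] at hspec
        exact absurd (by simpa using hspec 1 (by simp)) hx
      · rw [ht] at hspec
        have := hmin t (by omega)
        push Not at this
        obtain ⟨a, ha, hax⟩ := this
        refine ⟨a • x, hax, fun b hb => ?_⟩
        rw [smul_smul]
        exact hspec _ (by rw [pow_succ']; exact Ideal.mul_mem_mul hb ha)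
    let S : Submodule A N := Submodule.span A {y}
    -- `A` acts on `y` through its residue field, onto which `k` maps, so the `A`-span of `y` is a
    -- line over `k`. It has length and dimension `1` and can be split off.
    have hSk : S.restrictScalars k = Submodule.span k {y} := by
      refine le_antisymm (fun z hz => ?_) ?_
      · obtain ⟨a, rfl⟩ := Submodule.mem_span_singleton.1 (show z ∈ Submodule.span A {y} from hz)
        obtain ⟨c, hc⟩ := hres a
        refine Submodule.mem_span_singleton.2 ⟨c, ?_⟩
        have := hmy _ hc
        rw [sub_smul, sub_eq_zero] at this
        rw [this, algebraMap_smul]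
      · exact Submodule.span_le.2
          (Set.singleton_subset_iff.2 (Submodule.mem_span_singleton_self (R := A) y))
    have hS1 : Module.finrank k (S.restrictScalars k) = 1 := by
      rw [hSk]; exact finrank_span_singleton hy
    have hlen : Module.length A S = 1 := by
      apply le_antisymm
      · refine (Submodule.length_le_length_restrictScalars k S).trans ?_
        rw [Module.length_eq_finrank, hS1]
        rfl
      · have : Nontrivial S := ⟨⟨⟨y, Submodule.mem_span_singleton_self (R := A) y⟩, 0, fun h =>
          hy (congrArg Subtype.val h)⟩⟩
        exact Order.one_le_iff_pos.2 Module.length_pos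
    have hquot : Module.finrank k (N ⧸ S) + 1 = n := by
      rw [← hn, ← hS1]
      exact Submodule.finrank_quotient_add_finrank (S.restrictScalars k)
    have : Module.Finite k (N ⧸ S) :=
      inferInstanceAs (Module.Finite k (N ⧸ S.restrictScalars k))
    have hq := ih (Module.finrank k (N ⧸ S)) (by omega) (N ⧸ S) (fun z => by
      obtain ⟨z, rfl⟩ := Submodule.Quotient.mk_surjective S z
      obtain ⟨t, ht⟩ := htors z
      exact ⟨t, fun a ha => by rw [← Submodule.Quotient.mk_smul, ht a ha]; rfl⟩) rfl
    rw [Module.length_eq_add_of_exact S.subtype S.mkQ S.injective_subtype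
      (Submodule.mkQ_surjective S) (LinearMap.exact_subtype_mkQ S), hlen, hq, ← hquot]
    push_cast
    ring

variable {R : Type*} [CommRing R]

theorem mem_zerothLocalCohomology {𝔪 : Ideal R} {N : Type*} [AddCommGroup N] [Module R N] {x : N} :
    x ∈ zerothLocalCohomology 𝔪 N ↔ ∃ t : ℕ, ∀ a ∈ 𝔪 ^ t, a • x = 0 := by
  rw [zerothLocalCohomology, Submodule.mem_iSup_of_directed]
  · simp only [Submodule.mem_torsionBySet_iff]
    exact exists_congr fun t => ⟨fun h a ha => h ⟨a, ha⟩, fun h a => h a.1 a.2⟩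
  · refine Monotone.directed_le fun s t hst => ?_
    exact Submodule.torsionBySet_le_torsionBySet_of_subset (Ideal.pow_le_pow_right hst)

/-- Linear equivalences preserve the zeroth local cohomology. -/
noncomputable def zerothLocalCohomologyCongr (𝔪 : Ideal R) {N N' : Type*} [AddCommGroup N]
    [Module R N] [AddCommGroup N'] [Module R N'] (e : N ≃ₗ[R] N') :
    zerothLocalCohomology 𝔪 N ≃ₗ[R] zerothLocalCohomology 𝔪 N' :=
  e.ofSubmodules _ _ (by
    ext x
    simp only [Submodule.mem_map, mem_zerothLocalCohomology]
    constructor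
    · rintro ⟨y, ⟨t, ht⟩, rfl⟩
      exact ⟨t, fun a ha => by
        rw [LinearEquiv.coe_coe, ← map_smul, ht a ha, map_zero]⟩
    · rintro ⟨t, ht⟩
      exact ⟨e.symm x, ⟨t, fun a ha => by rw [← map_smul, ht a ha, map_zero]⟩, by simp⟩)

/-- The Hilbert-Kunz function of a cyclic module in terms of Frobenius powers of ideals. -/
theorem gHKFunction_quotient (p : ℕ) [ExpChar R p] (𝔪 I : Ideal R) (n : ℕ) :
    gHKFunction p R 𝔪 (R ⧸ I) n =
      Module.length R (zerothLocalCohomology 𝔪 (R ⧸ I.map (iterateFrobenius R p n))) := by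
  have e := (Algebra.TensorProduct.quotIdealMapEquivTensorQuot
    (FrobeniusTwist R p n) I).symm.toLinearEquiv
  rw [gHKFunction, (zerothLocalCohomologyCongr _ e).length_eq]
  have h : 𝔪.map (FrobeniusTwist.of R p n) = 𝔪 := Ideal.map_id 𝔪
  rw [h]
  rfl

theorem pow_smul_zerothLocalCohomology (𝔪 : Ideal R) {N : Type*} [AddCommGroup N] [Module R N]
    (x : zerothLocalCohomology 𝔪 N) : ∃ t : ℕ, ∀ a ∈ 𝔪 ^ t, a • x = 0 := by
  obtain ⟨t, ht⟩ := mem_zerothLocalCohomology.1 x.2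
  exact ⟨t, fun a ha => Subtype.ext (ht a ha)⟩

theorem mk_mem_zerothLocalCohomology {𝔪 K : Ideal R} {r : R} :
    Ideal.Quotient.mk K r ∈ zerothLocalCohomology 𝔪 (R ⧸ K) ↔
      ∃ t : ℕ, ∀ a ∈ 𝔪 ^ t, a * r ∈ K := by
  rw [mem_zerothLocalCohomology]
  refine exists_congr fun t => forall₂_congr fun a _ => ?_
  rw [← Ideal.Quotient.eq_zero_iff_mem]
  rfl

/-! ### Local cohomology and localization at a maximal ideal -/

section

variable (A : Type*) [CommRing A] [Algebra R A]

/-- The canonical map `R ⧸ K → A ⧸ K A`. -/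
def quotientToMapQuotient (K : Ideal R) : (R ⧸ K) →ₗ[R] A ⧸ K.map (algebraMap R A) :=
  (Ideal.quotientMapₐ (K.map (algebraMap R A)) (Algebra.ofId R A) Ideal.le_comap_map).toLinearMap

theorem quotientToMapQuotient_mk (K : Ideal R) (r : R) :
    quotientToMapQuotient A K (Ideal.Quotient.mk K r) = Ideal.Quotient.mk _ (algebraMap R A r) :=
  rfl

theorem quotientToMapQuotient_mem {J : Ideal R} (K : Ideal R) {x : R ⧸ K}
    (hx : x ∈ zerothLocalCohomology J (R ⧸ K)) :
    quotientToMapQuotient A K x ∈ zerothLocalCohomology (J.map (algebraMap R A))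
      (A ⧸ K.map (algebraMap R A)) := by
  obtain ⟨r, rfl⟩ := Ideal.Quotient.mk_surjective x
  rw [quotientToMapQuotient_mk, mk_mem_zerothLocalCohomology]
  obtain ⟨t, ht⟩ := mk_mem_zerothLocalCohomology.1 hx
  refine ⟨t, fun a ha => ?_⟩
  rw [← Ideal.map_pow] at ha
  have hle : (J ^ t).map (algebraMap R A) ≤ Submodule.comap
      (LinearMap.toSpanSingleton A A (algebraMap R A r)) (K.map (algebraMap R A)) := by
    refine Ideal.map_le_iff_le_comap.2 fun j hj => ?_
    change algebraMap R A j * algebraMap R A r ∈ K.map (algebraMap R A)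
    rw [← map_mul]
    exact Ideal.mem_map_of_mem _ (ht j hj)
  exact hle ha

end

variable {J : Ideal R} [hJ : J.IsMaximal]

/-- `(s)` and `J` are coprime because `J` is maximal, hence so are `(s)` and `J ^ t`. Denominators
from outside `J` are therefore already invertible on `J`-power torsion. -/
theorem exists_one_sub_mul_mem_pow {s : R} (hs : s ∉ J) (t : ℕ) : ∃ a, 1 - a * s ∈ J ^ t := by
  have hcop : IsCoprime (Ideal.span {s}) J := by
    obtain ⟨y, i, hi, h⟩ := hJ.exists_inv hs
    exact Ideal.isCoprime_iff_exists.2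
      ⟨y * s, Ideal.mul_mem_left _ _ (Ideal.mem_span_singleton_self s), i, hi, h⟩
  have := hcop.pow_right (n := t)
  rw [Ideal.isCoprime_iff_exists] at this
  obtain ⟨x, hx, j, hj, hxj⟩ := this
  obtain ⟨a, rfl⟩ := Ideal.mem_span_singleton'.1 hx
  exact ⟨a, by rw [← hxj, add_sub_cancel_left]; exact hj⟩

variable (A : Type*) [CommRing A] [Algebra R A] [IsLocalization.AtPrime A J]

theorem algebraMap_mem_map_iff (K : Ideal R) (r : R) :
    algebraMap R A r ∈ K.map (algebraMap R A) ↔ ∃ s ∉ J, s * r ∈ K := by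
  rw [IsLocalization.algebraMap_mem_map_algebraMap_iff J.primeCompl]
  rfl

theorem quotientToMapQuotient_injOn (K : Ideal R) {x : R ⧸ K}
    (hx : x ∈ zerothLocalCohomology J (R ⧸ K)) (h0 : quotientToMapQuotient A K x = 0) : x = 0 := by
  obtain ⟨r, rfl⟩ := Ideal.Quotient.mk_surjective x
  rw [quotientToMapQuotient_mk, Ideal.Quotient.eq_zero_iff_mem,
    algebraMap_mem_map_iff (J := J)] at h0
  obtain ⟨s, hs, hsr⟩ := h0
  obtain ⟨t, ht⟩ := mk_mem_zerothLocalCohomology.1 hx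
  obtain ⟨a, ha⟩ := exists_one_sub_mul_mem_pow hs t
  rw [Ideal.Quotient.eq_zero_iff_mem]
  have : r = a * (s * r) + (1 - a * s) * r := by ring
  rw [this]
  exact K.add_mem (K.mul_mem_left _ hsr) (ht _ ha)

theorem quotientToMapQuotient_surjOn (hfg : J.FG) (K : Ideal R) {y : A ⧸ K.map (algebraMap R A)}
    (hy : y ∈ zerothLocalCohomology (J.map (algebraMap R A)) (A ⧸ K.map (algebraMap R A))) :
    ∃ x ∈ zerothLocalCohomology J (R ⧸ K), quotientToMapQuotient A K x = y := by
  classical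
  obtain ⟨b, rfl⟩ := Ideal.Quotient.mk_surjective y
  obtain ⟨t, ht⟩ := mk_mem_zerothLocalCohomology.1 hy
  obtain ⟨⟨r, s⟩, hrs⟩ := IsLocalization.surj J.primeCompl b
  have hsJ : (s : R) ∉ J := s.2
  have hmul : ∀ j ∈ J ^ t, ∃ c ∉ J, c * (j * r) ∈ K := by
    intro j hj
    rw [← algebraMap_mem_map_iff A, map_mul]
    rw [← hrs, ← mul_assoc]
    refine Ideal.mul_mem_right _ _ (ht _ ?_)
    rw [← Ideal.map_pow]
    exact Ideal.mem_map_of_mem _ hj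
  -- A common denominator for all `j ∈ J ^ t`: the product of those of a finite generating set. This
  -- is where finite generation of `J` enters.
  obtain ⟨c, hc, hcK⟩ : ∃ c ∉ J, ∀ j ∈ J ^ t, j * (c * r) ∈ K := by
    obtain ⟨G, hG⟩ := hfg.pow (n := t)
    choose! c hc hcK using hmul
    have hGmem : ∀ g ∈ G, g ∈ J ^ t := fun g hg => hG ▸ Ideal.subset_span hg
    refine ⟨∏ g ∈ G, c g, ?_, ?_⟩
    · rw [Ideal.IsPrime.prod_mem_iff]
      rintro ⟨g, hg, hgJ⟩
      exact hc g (hGmem g hg) hgJ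
    · have hle : J ^ t ≤ Submodule.comap
          (LinearMap.toSpanSingleton R R ((∏ g ∈ G, c g) * r)) K := by
        rw [← hG]
        refine Submodule.span_le.2 fun g hg => ?_
        change g * ((∏ g ∈ G, c g) * r) ∈ K
        rw [← Finset.mul_prod_erase G c hg]
        have : g * (c g * (∏ x ∈ G.erase g, c x) * r) =
            (∏ x ∈ G.erase g, c x) * (c g * (g * r)) := by ring
        rw [this]
        exact K.mul_mem_left _ (hcK g (hGmem g hg))
      exact fun j hj => hle hj
  -- With `a` an inverse of `s c` modulo `J ^ t`, the element `a c r` represents the fraction `b = r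
  -- / s`.
  obtain ⟨a, ha⟩ := exists_one_sub_mul_mem_pow (J := J)
    (s := s * c) (fun h => (hJ.isPrime.mem_or_mem h).elim hsJ hc) t
  refine ⟨Ideal.Quotient.mk K (a * (c * r)), mk_mem_zerothLocalCohomology.2
    ⟨t, fun j hj => ?_⟩, ?_⟩
  · rw [mul_left_comm]
    exact K.mul_mem_left _ (hcK j hj)
  · rw [quotientToMapQuotient_mk, Ideal.Quotient.eq]
    have hunit : IsUnit (algebraMap R A s) := IsLocalization.map_units A s
    rw [← Ideal.unit_mul_mem_iff_mem _ hunit]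
    have h1 : algebraMap R A s * (algebraMap R A (a * (c * r)) - b) =
        - (algebraMap R A (1 - a * (s * c)) * b) * algebraMap R A s := by
      have h2 : b * algebraMap R A s = algebraMap R A r := hrs
      simp only [map_mul, map_sub, map_one, ← h2]
      ring
    rw [h1]
    refine Ideal.mul_mem_right _ _ (neg_mem (ht _ ?_))
    rw [← Ideal.map_pow]
    exact Ideal.mem_map_of_mem _ ha

/-- Zeroth local cohomology at a maximal ideal is unchanged by localization. -/
theorem nonempty_zerothLocalCohomology_equiv (k : Type*) [Field k] [Algebra k R] [Algebra k A]
    [IsScalarTower k R A] (hfg : J.FG) (K : Ideal R) :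
    Nonempty (zerothLocalCohomology J (R ⧸ K) ≃ₗ[k]
      zerothLocalCohomology (J.map (algebraMap R A)) (A ⧸ K.map (algebraMap R A))) := by
  let f : zerothLocalCohomology J (R ⧸ K) →ₗ[k]
      zerothLocalCohomology (J.map (algebraMap R A)) (A ⧸ K.map (algebraMap R A)) :=
    { toFun := fun x => ⟨quotientToMapQuotient A K x, quotientToMapQuotient_mem A K x.2⟩
      map_add' := fun x y => Subtype.ext (by simp)
      map_smul' := fun c x => Subtype.ext
        (((quotientToMapQuotient A K).restrictScalars k).map_smul c (x : R ⧸ K)) }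
  refine ⟨LinearEquiv.ofBijective f ⟨?_, fun y => ?_⟩⟩
  · rw [injective_iff_map_eq_zero]
    exact fun x hx => Subtype.ext
      (quotientToMapQuotient_injOn A K x.2 (congrArg Subtype.val hx))
  · obtain ⟨x, hx, h⟩ := quotientToMapQuotient_surjOn A hfg K y.2
    exact ⟨⟨x, hx⟩, Subtype.ext h⟩

theorem exists_sub_algebraMap_mem_map (k : Type*) [Field k] [Algebra k R] [Algebra k A]
    [IsScalarTower k R A] (hres : ∀ a : R, ∃ c : k, a - algebraMap k R c ∈ J) (b : A) :
    ∃ c : k, b - algebraMap k A c ∈ J.map (algebraMap R A) := by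
  obtain ⟨⟨r, s⟩, hrs⟩ := IsLocalization.surj J.primeCompl b
  have hrs' : b * algebraMap R A s = algebraMap R A r := hrs
  obtain ⟨a, ha⟩ := exists_one_sub_mul_mem_pow (J := J) (s := s) s.2 1
  obtain ⟨c, hc⟩ := hres (a * r)
  refine ⟨c, ?_⟩
  have h : b - algebraMap k A c = b * algebraMap R A (1 - a * s) +
      algebraMap R A (a * r - algebraMap k R c) := by
    rw [map_sub, map_sub, map_mul, map_mul, map_one, ← hrs', ← IsScalarTower.algebraMap_apply]
    ring
  rw [h]
  rw [pow_one] at ha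
  exact Ideal.add_mem _ (Ideal.mul_mem_left _ _ (Ideal.mem_map_of_mem _ ha))
    (Ideal.mem_map_of_mem _ hc)

end Length

/-! ### Toric rings and monomial ideals -/

section Toric

variable {d : ℕ} {σ : PointedCone ℝ (Fin d → ℝ)}

theorem conePoint_mem (a : coneMonoid σ) : conePoint a ∈ σ := a.2

theorem conePoint_add (a b : coneMonoid σ) : conePoint (a + b) = conePoint a + conePoint b := by
  simp [conePoint]

theorem conePoint_nsmul (n : ℕ) (a : coneMonoid σ) :
    conePoint (n • a) = (n : ℝ) • conePoint a := by
  change latticeEmbedding d (n • (a : Fin d → ℤ)) = _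
  rw [map_nsmul, Nat.cast_smul_eq_nsmul]
  rfl

theorem conePoint_injective : Function.Injective (conePoint (σ := σ)) := fun _ _ h =>
  Subtype.ext (latticeEmbedding_injective h)

theorem conePoint_eq_zero {a : coneMonoid σ} : conePoint a = 0 ↔ a = 0 :=
  ⟨fun h => conePoint_injective (h.trans (by simp [conePoint])), fun h => by simp [h, conePoint]⟩

theorem eq_zero_of_add_eq_zero_of_salient (hσ : (σ : ConvexCone ℝ (Fin d → ℝ)).Salient)
    {a b : coneMonoid σ} (h : a + b = 0) : b = 0 := by
  by_contra hb
  refine hσ (conePoint b) (conePoint_mem b) (mt conePoint_eq_zero.1 hb) ?_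
  have : conePoint a + conePoint b = 0 := by rw [← conePoint_add, h]; exact conePoint_eq_zero.2 rfl
  rw [neg_eq_of_add_eq_zero_left this]
  exact conePoint_mem a

theorem eq_zero_of_dotForm_eq_zero (hσ : (σ : ConvexCone ℝ (Fin d → ℝ)).Salient)
    (P : ConePresentation σ) {x : Fin d → ℝ} (hx : ∀ u ∈ P.ineqs, dotForm u x = 0) : x = 0 := by
  by_contra h
  refine hσ x ((P.mem_iff_ineqs x).2 fun u hu => (hx u hu).ge) h
    ((P.mem_iff_ineqs _).2 fun u hu => ?_)
  rw [map_neg, hx u hu, neg_zero]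

/-- **Gordan's lemma** for strongly convex cones. -/
theorem coneMonoid_fg (hσ : (σ : ConvexCone ℝ (Fin d → ℝ)).Salient) (P : ConePresentation σ) :
    AddMonoid.FG (coneMonoid σ) := by
  have hnn : ∀ (a : coneMonoid σ), ∀ u ∈ P.ineqs, 0 ≤ u ⬝ᵥ (a : Fin d → ℤ) := by
    intro a u hu
    have := (P.mem_iff_ineqs _).1 a.2 u hu
    rw [dotForm_latticeEmbedding] at this
    exact_mod_cast this
  -- The values of the defining inequalities embed the monoid into a power of `ℕ`, injectively since
  -- a salient cone contains no line. The image is closed under differences that stay in `ℕ`, which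
  -- makes it finitely generated.
  let f : coneMonoid σ →+ (P.ineqs → ℕ) :=
    { toFun := fun a u => (u.1 ⬝ᵥ (a : Fin d → ℤ)).toNat
      map_zero' := by funext u; simp
      map_add' := fun a b => by
        funext u
        simp only [AddSubmonoid.coe_add, dotProduct_add, Pi.add_apply]
        exact Int.toNat_add (hnn a u u.2) (hnn b u u.2) }
  have hf : ∀ a u, ((f a u : ℕ) : ℤ) = u.1 ⬝ᵥ (a : Fin d → ℤ) := fun a u =>
    Int.toNat_of_nonneg (hnn a u u.2)
  have hinj : Function.Injective f := by
    intro a b hab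
    have h0 := eq_zero_of_dotForm_eq_zero hσ P (x := conePoint a - conePoint b) fun u hu => by
      rw [map_sub, conePoint, conePoint, dotForm_latticeEmbedding, dotForm_latticeEmbedding,
        ← hf a ⟨u, hu⟩, ← hf b ⟨u, hu⟩, hab, sub_self]
    exact conePoint_injective (sub_eq_zero.1 h0)
  have hfg : (AddMonoidHom.mrange f).FG := by
    refine AddSubmonoid.fg_of_subtractive ?_
    rintro _ ⟨a, rfl⟩ y ⟨b, hb⟩
    have hval : ∀ u : P.ineqs, u.1 ⬝ᵥ ((b : Fin d → ℤ) - a) = y u := by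
      intro u
      rw [dotProduct_sub, ← hf, ← hf, hb]
      simp
    have hmem : (b : Fin d → ℤ) - a ∈ coneMonoid σ := by
      refine (P.mem_iff_ineqs _).2 fun u hu => ?_
      rw [dotForm_latticeEmbedding, hval ⟨u, hu⟩]
      positivity
    refine ⟨⟨_, hmem⟩, funext fun u => ?_⟩
    have := hf ⟨_, hmem⟩ u
    rw [hval] at this
    exact_mod_cast this
  have : AddMonoid.FG (AddMonoidHom.mrange f) := (AddMonoid.fg_iff_addSubmonoid_fg _).2 hfg
  let e : coneMonoid σ ≃+ AddMonoidHom.mrange f := AddEquiv.ofBijective f.mrangeRestrict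
    ⟨fun a b h => hinj (congrArg Subtype.val h), f.mrangeRestrict_surjective⟩
  exact AddMonoid.fg_of_surjective e.symm.toAddMonoidHom e.symm.surjective

variable (k : Type*) [Field k]

theorem toricRing_isNoetherianRing (hσ : (σ : ConvexCone ℝ (Fin d → ℝ)).Salient)
    (P : ConePresentation σ) : IsNoetherianRing (ToricRing k σ) := by
  have := coneMonoid_fg hσ P
  exact Algebra.FiniteType.isNoetherianRing k _

variable {k}

/-- In a salient cone `0` is not a sum with a nonzero summand, so no multiple of a nonconstant
monomial has a constant term. Thus `J` is the kernel of the constant coefficient and has residue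
field `k`. -/
theorem mem_toricMaximalIdeal (hσ : (σ : ConvexCone ℝ (Fin d → ℝ)).Salient)
    {f : ToricRing k σ} : f ∈ toricMaximalIdeal k σ ↔ f.coeff 0 = 0 := by
  have hset : {x : ToricRing k σ | ∃ m : coneMonoid σ, m ≠ 0 ∧ x = AddMonoidAlgebra.single m 1} =
      AddMonoidAlgebra.of' k (coneMonoid σ) '' {m | m ≠ 0} := by
    ext x
    simp only [Set.mem_ofPred_eq, Set.mem_image, AddMonoidAlgebra.of'_apply, eq_comm]
  rw [toricMaximalIdeal, hset, AddMonoidAlgebra.mem_ideal_span_of'_image]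
  constructor
  · intro h
    by_contra h0
    obtain ⟨m, hm, b, hb⟩ := h 0 (Finsupp.mem_support_iff.2 h0)
    exact hm (eq_zero_of_add_eq_zero_of_salient hσ hb.symm)
  · intro h m hm
    refine ⟨m, ?_, 0, (zero_add m).symm⟩
    rintro rfl
    exact Finsupp.mem_support_iff.1 hm h

theorem sub_algebraMap_mem_toricMaximalIdeal (hσ : (σ : ConvexCone ℝ (Fin d → ℝ)).Salient)
    (f : ToricRing k σ) : f - algebraMap k _ (f.coeff 0) ∈ toricMaximalIdeal k σ := by
  rw [mem_toricMaximalIdeal hσ]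
  simp [AddMonoidAlgebra.coe_algebraMap]

theorem toricMaximalIdeal_isMaximal (hσ : (σ : ConvexCone ℝ (Fin d → ℝ)).Salient) :
    (toricMaximalIdeal k σ).IsMaximal := by
  rw [Ideal.isMaximal_iff]
  refine ⟨?_, fun K f hle hf hfK => ?_⟩
  · rw [mem_toricMaximalIdeal hσ]
    simp [AddMonoidAlgebra.one_def]
  · have hc : f.coeff 0 ≠ 0 := mt (mem_toricMaximalIdeal hσ).2 hf
    have h1 : algebraMap k (ToricRing k σ) (f.coeff 0) ∈ K := by
      have := K.sub_mem hfK (hle (sub_algebraMap_mem_toricMaximalIdeal hσ f))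
      rwa [sub_sub_cancel] at this
    have h2 := K.mul_mem_left (algebraMap k (ToricRing k σ) (f.coeff 0)⁻¹) h1
    rwa [← map_mul, inv_mul_cancel₀ hc, map_one] at h2

theorem mem_monomialIdeal {s : ℕ} {m : Fin s → coneMonoid σ} {f : ToricRing k σ} :
    f ∈ monomialIdeal k m ↔ ∀ a ∈ f.coeff.support, ∃ i b, a = b + m i := by
  have hset : (Set.range fun i => AddMonoidAlgebra.single (m i) (1 : k)) =
      AddMonoidAlgebra.of' k (coneMonoid σ) '' Set.range m := by
    rw [← Set.range_comp]
    rfl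
  rw [monomialIdeal, hset, AddMonoidAlgebra.mem_ideal_span_of'_image]
  simp only [Set.exists_range_iff]

theorem single_mem_monomialIdeal {s : ℕ} {m : Fin s → coneMonoid σ} {a : coneMonoid σ} :
    AddMonoidAlgebra.single a (1 : k) ∈ monomialIdeal k m ↔ ∃ i b, a = b + m i := by
  classical
  rw [mem_monomialIdeal]
  simp

theorem monomialIdeal_map_iterateFrobenius (p n : ℕ) [ExpChar (ToricRing k σ) p] {s : ℕ}
    (m : Fin s → coneMonoid σ) :
    (monomialIdeal k m).map (iterateFrobenius (ToricRing k σ) p n) =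
      monomialIdeal k fun i => p ^ n • m i := by
  rw [monomialIdeal, Ideal.map_span, ← Set.range_comp, monomialIdeal]
  congr 2
  funext i
  simp [iterateFrobenius_def, AddMonoidAlgebra.single_pow]

/-! ### A monomial basis of the local cohomology -/

variable {s : ℕ} (m : Fin s → coneMonoid σ)

/-- Dividing exponents by `q` turns the varying ideals `I^[q]` into the one fixed region `W_I`. -/
theorem exists_eq_add_nsmul_iff (P : ConePresentation σ) {q : ℕ} (hq : 0 < q) {a : coneMonoid σ} :
    (∃ i b, a = b + q • m i) ↔ (q : ℝ)⁻¹ • conePoint a ∈ coneUnion m := by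
  have hq' : (0 : ℝ) < q := by exact_mod_cast hq
  rw [P.mem_coneUnion]
  refine exists_congr fun i => ?_
  have hle : ∀ u, dotForm u (conePoint (m i)) ≤ dotForm u ((q : ℝ)⁻¹ • conePoint a) ↔
      0 ≤ dotForm u (conePoint a - (q : ℝ) • conePoint (m i)) := by
    intro u
    rw [map_smul, map_sub, map_smul, smul_eq_mul, smul_eq_mul, le_inv_mul_iff₀ hq', sub_nonneg]
  simp only [hle, ← P.mem_iff_ineqs]
  constructor
  · rintro ⟨b, rfl⟩
    rw [conePoint_add, conePoint_nsmul, add_sub_cancel_right]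
    exact conePoint_mem b
  · intro h
    refine ⟨⟨(a : Fin d → ℤ) - (q • m i : coneMonoid σ), ?_⟩, Subtype.ext (by simp)⟩
    rw [← conePoint_nsmul] at h
    have : latticeEmbedding d ((a : Fin d → ℤ) - (q • m i : coneMonoid σ)) =
        conePoint a - conePoint (q • m i) := map_sub _ _ _
    exact (this ▸ h : latticeEmbedding d ((a : Fin d → ℤ) - (q • m i : coneMonoid σ)) ∈ σ)

/-- For a generator `w` of the cone, `X^(t w) ∈ J ^ t`, so `X^(a + t w) ∈ I^[q]` and `a/q + (t/q) w
∈ W_I`. Hence `a/q` enters `W_I` in every generator direction. -/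
theorem mem_locus_of_pow_mul_mem (P : ConePresentation σ) {q t : ℕ} (hq : 0 < q)
    {f : ToricRing k σ}
    (hf : ∀ g ∈ toricMaximalIdeal k σ ^ t, g * f ∈ monomialIdeal k fun i => q • m i)
    {a : coneMonoid σ} (ha : a ∈ f.coeff.support) :
    (q : ℝ)⁻¹ • conePoint a ∈ finiteColengthLocus m := by
  refine P.mem_locus_of_entersUnion fun w hw => ⟨t, ?_⟩
  let w' : coneMonoid σ := ⟨w, P.gens_mem hw⟩
  have hw' : w' ≠ 0 := fun h => P.gens_ne_zero w hw (congrArg Subtype.val h)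
  have hmem : (AddMonoidAlgebra.single (t • w') (1 : k) : ToricRing k σ) ∈
      toricMaximalIdeal k σ ^ t := by
    have h1 : (AddMonoidAlgebra.single w' (1 : k) : ToricRing k σ) ∈ toricMaximalIdeal k σ :=
      Ideal.subset_span ⟨w', hw', rfl⟩
    have := Ideal.pow_mem_pow h1 t
    rwa [AddMonoidAlgebra.single_pow, one_pow] at this
  have h2 := mem_monomialIdeal.1 (hf _ hmem) (t • w' + a) (by
    rw [Finsupp.mem_support_iff,
      AddMonoidAlgebra.coeff_single_mul_eq_mul_coeff a (by simp), one_mul]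
    exact Finsupp.mem_support_iff.1 ha)
  rw [exists_eq_add_nsmul_iff m P hq, conePoint_add, conePoint_nsmul, smul_add, add_comm] at h2
  have hq1 : (1 : ℝ) ≤ q := by exact_mod_cast hq
  -- `EntersUnion` asks for a natural multiple of `w`, so `t/q` is raised to `t`.
  have h3 : (((t : ℝ) - (q : ℝ)⁻¹ * t) • conePoint w') ∈ σ := by
    refine PointedCone.smul_mem σ ?_ (conePoint_mem w')
    rw [sub_nonneg]
    exact mul_le_of_le_one_left t.cast_nonneg (inv_le_one_of_one_le₀ hq1)
  convert P.add_mem_coneUnion h2 h3 using 1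
  change _ + (t : ℝ) • conePoint w' = _
  module

/-- Each monomial generator `X^b` of `J` has a power that multiplies `X^a` into `I^[q]`: `b`
involves some generator `w` of `σ` with positive coefficient, and large multiples of `b` go past the
entry time along `w`. As `J` is finitely generated, one power of `J` suffices. -/
theorem exists_pow_mul_mem_of_mem_locus (P : ConePresentation σ)
    (hσ : (σ : ConvexCone ℝ (Fin d → ℝ)).Salient)
    (hfull : Submodule.span ℝ (σ : Set (Fin d → ℝ)) = ⊤) {q : ℕ} (hq : 0 < q)
    {a : coneMonoid σ} (ha : (q : ℝ)⁻¹ • conePoint a ∈ finiteColengthLocus m) :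
    ∃ t : ℕ, ∀ g ∈ toricMaximalIdeal k σ ^ t,
      g * AddMonoidAlgebra.single a 1 ∈ monomialIdeal k fun i => q • m i := by
  have hq' : (0 : ℝ) < q := by exact_mod_cast hq
  let Q : Ideal (ToricRing k σ) := Submodule.comap
    (LinearMap.toSpanSingleton (ToricRing k σ) (ToricRing k σ) (AddMonoidAlgebra.single a 1))
    (monomialIdeal k fun i => q • m i)
  have hrad : toricMaximalIdeal k σ ≤ Q.radical := by
    refine Ideal.span_le.2 ?_
    rintro _ ⟨b, hb, rfl⟩
    obtain ⟨c, hc, hcb⟩ := (P.mem_iff_gens _).1 (conePoint_mem b)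
    obtain ⟨w, hw, hcw⟩ : ∃ w ∈ P.gens, c w ≠ 0 := by
      by_contra h
      push Not at h
      refine hb (conePoint_eq_zero.1 ?_)
      rw [← hcb]
      exact Finset.sum_eq_zero fun w hw => by rw [h w hw, zero_smul]
    obtain ⟨N, hN⟩ := (P.mem_locus_iff_entersUnion hfull).1 ha w hw
    have hcpos : 0 < c w := lt_of_le_of_ne (hc w) (Ne.symm hcw)
    -- This makes the coefficient `L c_w / q` of `w` in `(L b) / q` at least the entry time `N`.
    obtain ⟨L, hL⟩ := exists_nat_ge (N * q / c w)
    refine ⟨L, ?_⟩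
    change AddMonoidAlgebra.single b 1 ^ L * AddMonoidAlgebra.single a 1 ∈
      monomialIdeal k fun i => q • m i
    rw [AddMonoidAlgebra.single_pow, one_pow, AddMonoidAlgebra.single_mul_single, one_mul,
      single_mem_monomialIdeal, exists_eq_add_nsmul_iff m P hq, conePoint_add, conePoint_nsmul,
      ← hcb, smul_add, add_comm, smul_smul, Finset.smul_sum]
    simp only [smul_smul]
    have hLq : (0 : ℝ) ≤ (q : ℝ)⁻¹ * L := by positivity
    refine P.mem_coneUnion_of_le hN hw (c := fun w => (q : ℝ)⁻¹ * L * c w)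
      (fun w => mul_nonneg hLq (hc w)) ?_
    rw [div_le_iff₀ hcpos] at hL
    rw [mul_assoc, le_inv_mul_iff₀ hq', mul_comm]
    exact hL
  have := toricRing_isNoetherianRing k hσ P
  obtain ⟨t, ht⟩ := Ideal.exists_pow_le_of_le_radical_of_fg hrad (IsNoetherian.noetherian _)
  exact ⟨t, fun g hg => ht hg⟩

/-- The points of the cone outside `W_I` whose translated cone has finite volume outside `W_I`. -/
def locusDiff : Set (Fin d → ℝ) :=
  (finiteColengthLocus m ∩ (σ : Set (Fin d → ℝ))) \ coneUnion m

theorem inv_smul_mem_cone_iff {q : ℕ} (hq : 0 < q) {a : Fin d → ℤ} :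
    (q : ℝ)⁻¹ • latticeEmbedding d a ∈ σ ↔ a ∈ coneMonoid σ := by
  have hq' : (0 : ℝ) < q := by exact_mod_cast hq
  constructor
  · intro h
    have := PointedCone.smul_mem σ hq'.le h
    rwa [smul_inv_smul₀ hq'.ne'] at this
  · exact fun h => PointedCone.smul_mem σ (inv_nonneg.2 hq'.le) h

theorem finite_inv_smul_mem {E : Set (Fin d → ℝ)} (hE : Bornology.IsBounded E) {q : ℕ}
    (hq : 0 < q) : Finite {a : Fin d → ℤ // (q : ℝ)⁻¹ • latticeEmbedding d a ∈ E} := by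
  have hq' : (0 : ℝ) < q := by exact_mod_cast hq
  obtain ⟨r, hr⟩ := hE.exists_norm_le
  obtain ⟨N, hN⟩ := exists_nat_ge (q * r)
  refine ((Set.finite_Icc (fun _ => -(N : ℤ) : Fin d → ℤ) fun _ => (N : ℤ)).subset ?_).to_subtype
  intro a ha
  have hi : ∀ i, |a i| ≤ (N : ℤ) := by
    intro i
    have h1 := (norm_le_pi_norm _ i).trans (hr _ ha)
    rw [Pi.smul_apply, norm_smul, norm_inv, Real.norm_natCast, inv_mul_le_iff₀ hq'] at h1
    have h2 : |(a i : ℝ)| ≤ N := h1.trans hN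
    exact_mod_cast h2
  exact ⟨fun i => (abs_le.1 (hi i)).1, fun i => (abs_le.1 (hi i)).2⟩

/-- The exponents of the monomials that form a basis of the local cohomology. -/
abbrev LocusExponent (q : ℕ) : Type :=
  {a : coneMonoid σ // (q : ℝ)⁻¹ • conePoint a ∈ locusDiff m}

/-- Exponents in `σ ∩ M` are the same as lattice points `a` with `a / q ∈ D`. -/
def locusExponentEquiv {q : ℕ} (hq : 0 < q) : LocusExponent m q ≃
    {a : Fin d → ℤ // (q : ℝ)⁻¹ • latticeEmbedding d a ∈ locusDiff m} where
  toFun a := ⟨a.1, a.2⟩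
  invFun a := ⟨⟨a.1, (inv_smul_mem_cone_iff hq).1 a.2.1.2⟩, a.2⟩
  left_inv _ := rfl
  right_inv _ := rfl

/-- The class of a linear combination of the basis monomials. -/
noncomputable def locusMonomials (k : Type*) [Field k] (q : ℕ) : (LocusExponent m q →₀ k) →ₗ[k]
    ToricRing k σ ⧸ monomialIdeal k fun i => q • m i :=
  Finsupp.linearCombination k fun a => Ideal.Quotient.mk _ (AddMonoidAlgebra.single a.1 1)

theorem locusMonomials_injective (P : ConePresentation σ) {q : ℕ} (hq : 0 < q) :
    Function.Injective (locusMonomials m k q) := by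
  classical
  rw [injective_iff_map_eq_zero]
  intro c hc
  let f : ToricRing k σ := c.sum fun a r => AddMonoidAlgebra.single a.1 r
  have hf : locusMonomials m k q c = Ideal.Quotient.mk _ f := by
    rw [locusMonomials, Finsupp.linearCombination_apply, map_finsuppSum]
    refine Finsupp.sum_congr fun a _ => ?_
    rw [← Ideal.Quotient.mkₐ_eq_mk k, ← map_smul]
    simp
  have hcoeff : ∀ a : LocusExponent m q, f.coeff a.1 = c a := by
    intro a
    simp only [f, AddMonoidAlgebra.coeff_finsuppSum, Finsupp.sum_apply,
      AddMonoidAlgebra.coeff_single, Finsupp.single_apply]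
    rw [Finsupp.sum, Finset.sum_eq_single a]
    · simp
    · intro b _ hb
      rw [if_neg fun h => hb (Subtype.ext h)]
    · simp
  rw [hf, Ideal.Quotient.eq_zero_iff_mem, mem_monomialIdeal] at hc
  ext a
  by_contra h0
  have := hc a.1 (by rw [Finsupp.mem_support_iff, hcoeff]; exact h0)
  exact a.2.2 ((exists_eq_add_nsmul_iff m P hq).1 this)

/-- Since `I^[q]` is monomial, each exponent in the support of a torsion class can be treated
separately: it gives zero if `a/q ∈ W_I`, and otherwise `a/q` lies in `LC_I`. -/
theorem range_locusMonomials (P : ConePresentation σ)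
    (hσ : (σ : ConvexCone ℝ (Fin d → ℝ)).Salient)
    (hfull : Submodule.span ℝ (σ : Set (Fin d → ℝ)) = ⊤) {q : ℕ} (hq : 0 < q) :
    LinearMap.range (locusMonomials m k q) = (zerothLocalCohomology (toricMaximalIdeal k σ)
      (ToricRing k σ ⧸ monomialIdeal k fun i => q • m i)).restrictScalars k := by
  apply le_antisymm
  · rintro _ ⟨c, rfl⟩
    rw [locusMonomials, Finsupp.linearCombination_apply]
    refine Submodule.sum_mem _ fun a _ => Submodule.smul_mem _ _ ?_
    exact mk_mem_zerothLocalCohomology.2 (exists_pow_mul_mem_of_mem_locus m P hσ hfull hq a.2.1.1)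
  · intro x hx
    obtain ⟨f, rfl⟩ := Ideal.Quotient.mk_surjective x
    obtain ⟨t, ht⟩ := mk_mem_zerothLocalCohomology.1 hx
    rw [← f.sum_coeff_single, map_finsuppSum]
    refine Submodule.sum_mem _ fun a ha => ?_
    beta_reduce
    by_cases hW : (q : ℝ)⁻¹ • conePoint a ∈ coneUnion m
    · have : Ideal.Quotient.mk (monomialIdeal k fun i => q • m i)
          (AddMonoidAlgebra.single a (f.coeff a)) = 0 := by
        rw [Ideal.Quotient.eq_zero_iff_mem, mem_monomialIdeal]
        intro b hb
        have hba : b = a := Finset.mem_singleton.1 (Finsupp.support_single_subset hb)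
        rw [hba]
        exact (exists_eq_add_nsmul_iff m P hq).2 hW
      rw [this]
      exact Submodule.zero_mem _
    · have hmem : (q : ℝ)⁻¹ • conePoint a ∈ locusDiff m :=
        ⟨⟨mem_locus_of_pow_mul_mem m P hq ht ha, (inv_smul_mem_cone_iff hq).2 a.2⟩, hW⟩
      refine ⟨Finsupp.single ⟨a, hmem⟩ (f.coeff a), ?_⟩
      rw [locusMonomials, Finsupp.linearCombination_single, ← Ideal.Quotient.mkₐ_eq_mk k,
        ← map_smul]
      simp

/-- The local cohomology has the monomials with exponents in `q D` as a basis. -/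
noncomputable def locusMonomialsEquiv (k : Type*) [Field k] (P : ConePresentation σ)
    (hσ : (σ : ConvexCone ℝ (Fin d → ℝ)).Salient)
    (hfull : Submodule.span ℝ (σ : Set (Fin d → ℝ)) = ⊤) {q : ℕ} (hq : 0 < q) :
    (LocusExponent m q →₀ k) ≃ₗ[k] zerothLocalCohomology (toricMaximalIdeal k σ)
      (ToricRing k σ ⧸ monomialIdeal k fun i => q • m i) :=
  (LinearEquiv.ofInjective _ (locusMonomials_injective m P hq)).trans
    (LinearEquiv.ofEq _ _ (range_locusMonomials m P hσ hfull hq))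

end Toric

/-! ### The dimension of a toric ring -/

section Dimension

/-- The dimension does not grow in an integral extension. -/
theorem ringKrullDim_le_of_algebra_isIntegral (A B : Type*) [CommRing A] [CommRing B] [Algebra A B]
    [Algebra.IsIntegral A B] : ringKrullDim B ≤ ringKrullDim A :=
  Order.krullDim_le_of_strictMono (PrimeSpectrum.comap (algebraMap A B)) fun _ _ hpq =>
    Ideal.IsIntegral.comap_lt_comap hpq

/-- The dimension of an algebra of finite type is at most the transcendence degree of any
algebra that contains it. -/
theorem ringKrullDim_le_of_trdeg_le (k : Type*) [Field k] (R A : Type*) [CommRing R] [Nontrivial R]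
    [Algebra k R] [Algebra.FiniteType k R] [CommRing A] [Algebra k A]
    (f : R →ₐ[k] A) (hf : Function.Injective f) {d : ℕ} (hd : Algebra.trdeg k A ≤ d) :
    ringKrullDim R ≤ d := by
  -- Noether normalization: `R` is integral over a polynomial ring in `s` variables, and `s` is
  -- bounded by the transcendence degree of `A`.
  obtain ⟨s, g, hg, hint⟩ := exists_integral_inj_algHom_of_fg k R
  have hs : s ≤ d := by
    have h := lift_trdeg_le_of_injective (f.comp g) (hf.comp hg)
    rw [MvPolynomial.trdeg_of_isDomain] at h
    have h2 := h.trans (Cardinal.lift_le.2 hd)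
    simpa using h2
  let _ : Algebra (MvPolynomial (Fin s) k) R := g.toRingHom.toAlgebra
  have : Algebra.IsIntegral (MvPolynomial (Fin s) k) R := ⟨hint⟩
  refine (ringKrullDim_le_of_algebra_isIntegral (MvPolynomial (Fin s) k) R).trans ?_
  rw [MvPolynomial.ringKrullDim_of_isNoetherianRing, ringKrullDim_eq_zero_of_field]
  simpa using hs

variable (k : Type*) [Field k] {d : ℕ}

/-- The inverse of a variable `xᵢ` is a root of `xᵢ T - 1`, so the Laurent ring is algebraic over
the subalgebra generated by the `d` variables. -/
theorem trdeg_laurent_le : Algebra.trdeg k (AddMonoidAlgebra k (Fin d → ℤ)) ≤ d := by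
  let x : Fin d → (AddMonoidAlgebra k (Fin d → ℤ)) := fun i => AddMonoidAlgebra.single (Pi.single i 1) 1
  let y : Fin d → (AddMonoidAlgebra k (Fin d → ℤ)) := fun i => AddMonoidAlgebra.single (-Pi.single i 1) 1
  let B := Algebra.adjoin k (Set.range x)
  let C := Subalgebra.algebraicClosure B (AddMonoidAlgebra k (Fin d → ℤ))
  have hx : ∀ i, x i ∈ C := fun i =>
    isAlgebraic_algebraMap (⟨x i, Algebra.subset_adjoin ⟨i, rfl⟩⟩ : B)
  have hxy : ∀ i, x i * y i = 1 := fun i => by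
    simp only [x, y, AddMonoidAlgebra.single_mul_single, AddMonoidAlgebra.one_def,
      add_neg_cancel, one_mul]
  have hy : ∀ i, y i ∈ C := by
    intro i
    refine ⟨Polynomial.C (⟨x i, Algebra.subset_adjoin ⟨i, rfl⟩⟩ : B) * Polynomial.X - 1, ?_, ?_⟩
    · intro h
      have := congrArg (Polynomial.eval 0) h
      simp at this
    · have : algebraMap B (AddMonoidAlgebra k (Fin d → ℤ)) ⟨x i, Algebra.subset_adjoin ⟨i, rfl⟩⟩ = x i := rfl
      simp [this, hxy]
  have hmono : ∀ a : Fin d → ℤ, (AddMonoidAlgebra.single a 1 : (AddMonoidAlgebra k (Fin d → ℤ))) ∈ C := by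
    let S : AddSubmonoid (Fin d → ℤ) :=
      { carrier := {a | (AddMonoidAlgebra.single a 1 : (AddMonoidAlgebra k (Fin d → ℤ))) ∈ C}
        zero_mem' := C.one_mem
        add_mem' := fun {a b} ha hb => by
          have := C.mul_mem ha hb
          rwa [AddMonoidAlgebra.single_mul_single, one_mul] at this }
    have hS : ∀ i (n : ℤ), Pi.single i n ∈ S := by
      intro i n
      rcases n.eq_nat_or_neg with ⟨l, rfl | rfl⟩
      · have := S.nsmul_mem (show Pi.single i 1 ∈ S from hx i) l
        rw [← Pi.single_smul] at this
        simpa using this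
      · have := S.nsmul_mem (show -Pi.single i 1 ∈ S from hy i) l
        rw [← Pi.single_neg, ← Pi.single_smul] at this
        simpa using this
    intro a
    have : ∑ i, Pi.single i (a i) ∈ S := S.sum_mem fun i _ => hS i (a i)
    rwa [Finset.univ_sum_single] at this
  have halg : Algebra.IsAlgebraic B (AddMonoidAlgebra k (Fin d → ℤ)) := by
    refine ⟨fun f => ?_⟩
    change f ∈ C
    rw [← f.sum_coeff_single]
    refine C.sum_mem fun a _ => ?_
    have : AddMonoidAlgebra.single a (f.coeff a) =
        algebraMap B (AddMonoidAlgebra k (Fin d → ℤ)) (algebraMap k B (f.coeff a)) *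
          AddMonoidAlgebra.single a 1 := by
      rw [← IsScalarTower.algebraMap_apply, ← Algebra.smul_def, AddMonoidAlgebra.smul_single,
        smul_eq_mul, mul_one]
    rw [this]
    exact C.mul_mem (C.algebraMap_mem _) (hmono a)
  refine (Algebra.IsAlgebraic.trdeg_le_cardinalMk k (Set.range x)).trans ?_
  have h := Cardinal.mk_range_le_lift (f := x)
  simpa using h

/-! ### Chains of primes in the toric ring -/

variable {σ : PointedCone ℝ (Fin d → ℝ)}

theorem ringKrullDim_toricRing_le (hσ : (σ : ConvexCone ℝ (Fin d → ℝ)).Salient)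
    (P : ConePresentation σ) : ringKrullDim (ToricRing k σ) ≤ d := by
  have := coneMonoid_fg hσ P
  refine ringKrullDim_le_of_trdeg_le k (ToricRing k σ) (AddMonoidAlgebra k (Fin d → ℤ))
    (AddMonoidAlgebra.mapDomainAlgHom k k (coneMonoid σ).subtype) ?_ (trdeg_laurent_le k)
  exact AddMonoidAlgebra.mapDomain_injective Subtype.val_injective

/-- The sum `z` of the generators pairs to at least `1` with each inequality, by integrality, so a
large multiple of `z` moves any lattice point into `σ`. -/
theorem exists_sub_eq_of_full (P : ConePresentation σ)
    (hfull : Submodule.span ℝ (σ : Set (Fin d → ℝ)) = ⊤) (a : Fin d → ℤ) :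
    ∃ x y : coneMonoid σ, (x : Fin d → ℤ) = a + y := by
  set z : Fin d → ℤ := ∑ w ∈ P.gens, w
  have hz : ∀ u ∈ P.ineqs, 0 < u ⬝ᵥ z := by
    intro u hu
    have := P.dotForm_sum_pos hfull hu
    rw [← map_sum, dotForm_latticeEmbedding] at this
    exact_mod_cast this
  have hmem : ∀ b : Fin d → ℤ, b ∈ coneMonoid σ ↔ ∀ u ∈ P.ineqs, 0 ≤ u ⬝ᵥ b := by
    intro b
    refine (P.mem_iff_ineqs _).trans (forall₂_congr fun u _ => ?_)
    rw [dotForm_latticeEmbedding, Int.cast_nonneg_iff]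
  set N : ℕ := ∑ u ∈ P.ineqs, (u ⬝ᵥ a).natAbs
  have hN : ∀ u ∈ P.ineqs, -(N : ℤ) ≤ u ⬝ᵥ a := by
    intro u hu
    have h1 : (u ⬝ᵥ a).natAbs ≤ N :=
      Finset.single_le_sum (f := fun u => (u ⬝ᵥ a).natAbs) (fun _ _ => Nat.zero_le _) hu
    omega
  refine ⟨⟨a + (N : ℤ) • z, (hmem _).2 fun u hu => ?_⟩, ⟨(N : ℤ) • z, (hmem _).2 fun u hu => ?_⟩,
    rfl⟩
  · rw [dotProduct_add, dotProduct_smul, smul_eq_mul]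
    nlinarith [hN u hu, hz u hu, (Int.natCast_nonneg N)]
  · rw [dotProduct_smul, smul_eq_mul]
    exact mul_nonneg (Int.natCast_nonneg N) (hz u hu).le

/-- The ring map on group algebras induced by a homomorphism out of the lattice. -/
noncomputable def latticeRingHom (σ : PointedCone ℝ (Fin d → ℝ))
    (φ : (Fin d → ℤ) →+ (Fin d → ℤ)) : ToricRing k σ →+* AddMonoidAlgebra k (Fin d → ℤ) :=
  AddMonoidAlgebra.mapDomainRingHom k (φ.comp (coneMonoid σ).subtype)

variable {k}

theorem latticeRingHom_single (φ : (Fin d → ℤ) →+ (Fin d → ℤ)) (a : coneMonoid σ) :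
    latticeRingHom k σ φ (AddMonoidAlgebra.single a 1) =
      AddMonoidAlgebra.single (φ (a : Fin d → ℤ)) 1 := by
  simp [latticeRingHom]

/-- Write `a = x - y` with `x, y ∈ σ ∩ M`. The binomial `X^x - X^y` is killed by the composite but
not by the map of `φ`. -/
theorem ker_latticeRingHom_lt (P : ConePresentation σ)
    (hfull : Submodule.span ℝ (σ : Set (Fin d → ℝ)) = ⊤) (φ ψ : (Fin d → ℤ) →+ (Fin d → ℤ))
    {a : Fin d → ℤ} (ha : φ a ≠ 0) (ha' : ψ (φ a) = 0) :
    RingHom.ker (latticeRingHom k σ φ) < RingHom.ker (latticeRingHom k σ (ψ.comp φ)) := by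
  have hcomp : latticeRingHom k σ (ψ.comp φ) =
      (AddMonoidAlgebra.mapDomainRingHom k ψ).comp (latticeRingHom k σ φ) := by
    rw [latticeRingHom, latticeRingHom, ← AddMonoidAlgebra.mapDomainRingHom_comp]
    rfl
  refine lt_of_le_of_ne (fun f hf => ?_) fun heq => ?_
  · rw [RingHom.mem_ker] at hf ⊢
    rw [hcomp, RingHom.comp_apply, hf, map_zero]
  · obtain ⟨x, y, hxy⟩ := exists_sub_eq_of_full P hfull a
    have hmem : (AddMonoidAlgebra.single x 1 - AddMonoidAlgebra.single y 1 : ToricRing k σ) ∈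
        RingHom.ker (latticeRingHom k σ (ψ.comp φ)) := by
      rw [RingHom.mem_ker, map_sub, latticeRingHom_single, latticeRingHom_single, hxy, map_add]
      simp [ha']
    rw [← heq, RingHom.mem_ker, map_sub, latticeRingHom_single, latticeRingHom_single,
      sub_eq_zero, AddMonoidAlgebra.single_left_inj one_ne_zero, hxy, map_add] at hmem
    exact ha (by simpa using hmem)

/-- The map that records `⟨u, a⟩` in the coordinate `i₀`, forgets the coordinates in `C`, and
keeps the others. -/
def coordinateMap (u : Fin d → ℤ) (i₀ : Fin d) (C : Finset (Fin d)) :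
    (Fin d → ℤ) →+ (Fin d → ℤ) where
  toFun a i := if i ∈ C then 0 else if i = i₀ then u ⬝ᵥ a else a i
  map_zero' := by funext i; simp
  map_add' a b := by
    funext i
    by_cases hi : i ∈ C
    · simp [hi]
    · by_cases hi' : i = i₀
      · subst hi'; simp [hi, dotProduct_add]
      · simp [hi, hi']

/-- The map that forgets the coordinate `c`. -/
def forgetCoordinate (c : Fin d) : (Fin d → ℤ) →+ (Fin d → ℤ) where
  toFun a := Function.update a c 0
  map_zero' := Function.update_eq_self c (0 : Fin d → ℤ)
  map_add' a b := by
    funext i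
    by_cases hi : i = c
    · subst hi; simp
    · simp [hi]

theorem forgetCoordinate_comp (u : Fin d → ℤ) (i₀ c : Fin d) (C : Finset (Fin d)) :
    (forgetCoordinate c).comp (coordinateMap u i₀ C) = coordinateMap u i₀ (insert c C) := by
  ext a i
  by_cases hi : i = c
  · subst hi; simp [forgetCoordinate, coordinateMap]
  · simp [forgetCoordinate, coordinateMap, hi]

/-- The kernels are prime because Laurent polynomials form a domain, and forgetting one more
coordinate enlarges the kernel strictly. -/
theorem card_le_height_ker (P : ConePresentation σ)
    (hfull : Submodule.span ℝ (σ : Set (Fin d → ℝ)) = ⊤) {u : Fin d → ℤ} {i₀ : Fin d}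
    (hu : u i₀ ≠ 0) (C : Finset (Fin d)) (hC : i₀ ∉ C) :
    (C.card : ℕ∞) ≤ (RingHom.ker (latticeRingHom k σ (coordinateMap u i₀ C))).height := by
  induction C using Finset.induction_on with
  | empty => simp
  | insert c C hc ih =>
    rw [Finset.mem_insert, not_or] at hC
    rw [Finset.card_insert_of_notMem hc, Nat.cast_succ]
    refine (add_le_add_left (ih hC.2) 1).trans ?_
    have hp := RingHom.ker_isPrime (latticeRingHom k σ (coordinateMap u i₀ C))
    have hp' := RingHom.ker_isPrime (latticeRingHom k σ (coordinateMap u i₀ (insert c C)))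
    refine Ideal.height_add_one_le_of_lt_of_isPrime ?_
    -- This vector is orthogonal to `u`, so its only surviving coordinate is the one at `c`, the
    -- next to be forgotten.
    have hval : coordinateMap u i₀ C (Pi.single c (u i₀) - Pi.single i₀ (u c)) =
        Pi.single c (u i₀) := by
      funext i
      by_cases hi : i ∈ C
      · have hic : i ≠ c := fun h => hc (h ▸ hi)
        simp [coordinateMap, hi, hic]
      · by_cases hi' : i = i₀
        · subst hi'
          simp [coordinateMap, hi, hC.1, dotProduct_sub, mul_comm]
        · simp [coordinateMap, hi, hi', Pi.single_apply]
    rw [← forgetCoordinate_comp]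
    refine ker_latticeRingHom_lt P hfull (coordinateMap u i₀ C) (forgetCoordinate c)
      (a := Pi.single c (u i₀) - Pi.single i₀ (u c)) ?_ ?_
    · rw [hval]
      intro h
      have := congrFun h c
      simp [hu] at this
    · rw [hval]
      funext i
      by_cases hi : i = c
      · subst hi; simp [forgetCoordinate]
      · simp [forgetCoordinate, hi]

theorem coeff_zero_latticeRingHom {φ : (Fin d → ℤ) →+ (Fin d → ℤ)}
    (hφ : ∀ a : coneMonoid σ, φ (a : Fin d → ℤ) = 0 → a = 0) (f : ToricRing k σ) :
    (latticeRingHom k σ φ f).coeff 0 = f.coeff 0 := by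
  induction f using AddMonoidAlgebra.induction_linear with
  | zero => simp
  | add f g hf hg => simp [hf, hg]
  | single a r =>
    classical
    have : latticeRingHom k σ φ (AddMonoidAlgebra.single a r) =
      AddMonoidAlgebra.single (φ (a : Fin d → ℤ)) r := by simp [latticeRingHom]
    rw [this, AddMonoidAlgebra.coeff_single, AddMonoidAlgebra.coeff_single, Finsupp.single_apply,
      Finsupp.single_apply]
    by_cases ha : a = 0
    · simp [ha]
    · rw [if_neg ha, if_neg (mt (hφ a) ha)]

theorem le_height_toricMaximalIdeal (hσ : (σ : ConvexCone ℝ (Fin d → ℝ)).Salient)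
    (P : ConePresentation σ) (hfull : Submodule.span ℝ (σ : Set (Fin d → ℝ)) = ⊤) :
    (d : ℕ∞) ≤ (toricMaximalIdeal k σ).height := by
  rcases Nat.eq_zero_or_pos d with hd | hd
  · subst hd; simp
  obtain ⟨w, hw⟩ : P.gens.Nonempty := by
    rw [Finset.nonempty_iff_ne_empty]
    intro h
    obtain ⟨x, y, hxy⟩ := exists_sub_eq_of_full P hfull (Pi.single ⟨0, hd⟩ 1)
    have hzero : ∀ x : coneMonoid σ, (x : Fin d → ℤ) = 0 := by
      intro x
      obtain ⟨c, -, hc⟩ := (P.mem_iff_gens _).1 x.2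
      rw [h, Finset.sum_empty] at hc
      exact latticeEmbedding_injective (hc.symm.trans (map_zero _).symm)
    rw [hzero, hzero, add_zero] at hxy
    simpa using congrFun hxy ⟨0, hd⟩
  -- The sum of the inequalities is positive on nonzero points of a salient cone. The grading by `u`
  -- is what remains once all coordinates but `i₀` are forgotten, so that last kernel has height at
  -- least `d - 1` and still lies strictly inside `J`.
  set u : Fin d → ℤ := ∑ v ∈ P.ineqs, v
  have hpos : ∀ a : coneMonoid σ, u ⬝ᵥ (a : Fin d → ℤ) = 0 → a = 0 := by
    intro a ha
    have h1 : dotForm u (conePoint a) = 0 := by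
      rw [conePoint, dotForm_latticeEmbedding, ha, Int.cast_zero]
    rw [dotForm_sum] at h1
    have h2 := (Finset.sum_eq_zero_iff_of_nonneg fun v hv =>
      (P.mem_iff_ineqs _).1 (conePoint_mem a) v hv).1 h1
    exact conePoint_eq_zero.1 (eq_zero_of_dotForm_eq_zero hσ P h2)
  let w' : coneMonoid σ := ⟨w, P.gens_mem hw⟩
  have hw' : w' ≠ 0 := fun h => P.gens_ne_zero w hw (congrArg Subtype.val h)
  obtain ⟨i₀, hi₀⟩ : ∃ i, u i ≠ 0 := by
    by_contra h
    push Not at h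
    exact hw' (hpos w' (by rw [show u = 0 from funext h, zero_dotProduct]))
  have hφ : ∀ a : coneMonoid σ,
      coordinateMap u i₀ (Finset.univ.erase i₀) (a : Fin d → ℤ) = 0 → a = 0 := by
    intro a ha
    refine hpos a ?_
    simpa [coordinateMap] using congrFun ha i₀
  have hp := RingHom.ker_isPrime
    (latticeRingHom k σ (coordinateMap u i₀ (Finset.univ.erase i₀)))
  have hJ := (toricMaximalIdeal_isMaximal (k := k) hσ).isPrime
  have h1 := card_le_height_ker (k := k) P hfull hi₀ (Finset.univ.erase i₀) (by simp)
  rw [Finset.card_erase_of_mem (Finset.mem_univ _), Finset.card_fin] at h1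
  have hlt : RingHom.ker (latticeRingHom k σ (coordinateMap u i₀ (Finset.univ.erase i₀))) <
      toricMaximalIdeal k σ := by
    refine lt_of_le_of_ne (fun f hf => ?_) fun heq => ?_
    · rw [mem_toricMaximalIdeal hσ, ← coeff_zero_latticeRingHom hφ f, RingHom.mem_ker.1 hf]
      simp
    · have hmem : (AddMonoidAlgebra.single w' 1 : ToricRing k σ) ∈ toricMaximalIdeal k σ :=
        Ideal.subset_span ⟨w', hw', rfl⟩
      rw [← heq, RingHom.mem_ker, latticeRingHom_single, AddMonoidAlgebra.single_eq_zero] at hmem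
      exact one_ne_zero hmem
  calc (d : ℕ∞) = ((d - 1 : ℕ) : ℕ∞) + 1 := by
        rw [← Nat.cast_succ, Nat.succ_eq_add_one, Nat.sub_add_cancel hd]
    _ ≤ _ := add_le_add_left h1 1
    _ ≤ _ := Ideal.height_add_one_le_of_lt_of_isPrime hlt

theorem height_toricMaximalIdeal (hσ : (σ : ConvexCone ℝ (Fin d → ℝ)).Salient)
    (P : ConePresentation σ) (hfull : Submodule.span ℝ (σ : Set (Fin d → ℝ)) = ⊤) :
    (toricMaximalIdeal k σ).height = d := by
  have := (toricMaximalIdeal_isMaximal (k := k) hσ).isPrime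
  refine le_antisymm ?_ (le_height_toricMaximalIdeal hσ P hfull)
  have h := (Ideal.height_le_ringKrullDim_of_isPrime (I := toricMaximalIdeal k σ)).trans
    (ringKrullDim_toricRing_le k hσ P)
  exact_mod_cast h

theorem ringKrullDim_toricRing (hσ : (σ : ConvexCone ℝ (Fin d → ℝ)).Salient)
    (P : ConePresentation σ) (hfull : Submodule.span ℝ (σ : Set (Fin d → ℝ)) = ⊤) :
    ringKrullDim (ToricRing k σ) = d := by
  have := (toricMaximalIdeal_isMaximal (k := k) hσ).isPrime
  refine le_antisymm (ringKrullDim_toricRing_le k hσ P) ?_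
  have h := Ideal.height_le_ringKrullDim_of_isPrime (I := toricMaximalIdeal k σ)
  rw [height_toricMaximalIdeal hσ P hfull] at h
  exact_mod_cast h

end Dimension

/-! ### The generalized Hilbert-Kunz multiplicity of a monomial ideal -/

section Multiplicity

variable {d : ℕ} {σ : PointedCone ℝ (Fin d → ℝ)} {k : Type*} [Field k] {s : ℕ}

theorem finite_zerothLocalCohomology_monomialIdeal (m : Fin s → coneMonoid σ)
    (P : ConePresentation σ) (hσ : (σ : ConvexCone ℝ (Fin d → ℝ)).Salient)
    (hfull : Submodule.span ℝ (σ : Set (Fin d → ℝ)) = ⊤) {q : ℕ} (hq : 0 < q) :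
    Module.Finite k (zerothLocalCohomology (toricMaximalIdeal k σ)
        (ToricRing k σ ⧸ monomialIdeal k fun i => q • m i)) ∧
      Module.finrank k (zerothLocalCohomology (toricMaximalIdeal k σ)
        (ToricRing k σ ⧸ monomialIdeal k fun i => q • m i)) =
      Nat.card {a : Fin d → ℤ // (q : ℝ)⁻¹ • latticeEmbedding d a ∈ locusDiff m} := by
  have : Finite {a : Fin d → ℤ // (q : ℝ)⁻¹ • latticeEmbedding d a ∈ locusDiff m} :=
    finite_inv_smul_mem (P.isBounded_locus_diff hfull m) hq
  have hfin : Finite (LocusExponent m q) := Finite.of_equiv _ (locusExponentEquiv m hq).symm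
  have := Fintype.ofFinite (LocusExponent m q)
  refine ⟨Module.Finite.equiv (locusMonomialsEquiv m k P hσ hfull hq), ?_⟩
  rw [← (locusMonomialsEquiv m k P hσ hfull hq).finrank_eq, Module.finrank_finsupp_self,
    ← Nat.card_eq_fintype_card]
  exact Nat.card_congr (locusExponentEquiv m hq)

theorem gHKFunction_toricRing (p : ℕ) [ExpChar (ToricRing k σ) p] (hp : 0 < p)
    (m : Fin s → coneMonoid σ) (P : ConePresentation σ)
    (hσ : (σ : ConvexCone ℝ (Fin d → ℝ)).Salient)
    (hfull : Submodule.span ℝ (σ : Set (Fin d → ℝ)) = ⊤) (n : ℕ) :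
    gHKFunction p (ToricRing k σ) (toricMaximalIdeal k σ)
      (ToricRing k σ ⧸ monomialIdeal k m) n =
    Nat.card {a : Fin d → ℤ // ((p ^ n : ℕ) : ℝ)⁻¹ • latticeEmbedding d a ∈ locusDiff m} := by
  obtain ⟨hfin, hrank⟩ := finite_zerothLocalCohomology_monomialIdeal (k := k) m P hσ hfull
    (pow_pos hp n)
  rw [gHKFunction_quotient, monomialIdeal_map_iterateFrobenius, ← hrank]
  exact Module.length_eq_finrank_of_forall_exists_pow_smul k (toricMaximalIdeal k σ)
    (fun f => ⟨_, sub_algebraMap_mem_toricMaximalIdeal hσ f⟩) _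
    (pow_smul_zerothLocalCohomology _)

theorem gHKFunction_localization (p : ℕ) [ExpChar (ToricRing k σ) p] (hp : 0 < p)
    (m : Fin s → coneMonoid σ) (P : ConePresentation σ)
    (hσ : (σ : ConvexCone ℝ (Fin d → ℝ)).Salient)
    (hfull : Submodule.span ℝ (σ : Set (Fin d → ℝ)) = ⊤) (n : ℕ)
    [hJ : (toricMaximalIdeal k σ).IsMaximal]
    [ExpChar (Localization.AtPrime (toricMaximalIdeal k σ)) p] :
    gHKFunction p (Localization.AtPrime (toricMaximalIdeal k σ))
      (IsLocalRing.maximalIdeal (Localization.AtPrime (toricMaximalIdeal k σ)))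
      (Localization.AtPrime (toricMaximalIdeal k σ) ⧸ (monomialIdeal k m).map
        (algebraMap (ToricRing k σ) (Localization.AtPrime (toricMaximalIdeal k σ)))) n =
    Nat.card {a : Fin d → ℤ // ((p ^ n : ℕ) : ℝ)⁻¹ • latticeEmbedding d a ∈ locusDiff m} := by
  obtain ⟨hfin, hrank⟩ := finite_zerothLocalCohomology_monomialIdeal (k := k) m P hσ hfull
    (pow_pos hp n)
  have hcomm : ((monomialIdeal k m).map (algebraMap (ToricRing k σ)
      (Localization.AtPrime (toricMaximalIdeal k σ)))).map (iterateFrobenius _ p n) =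
      (monomialIdeal k fun i => p ^ n • m i).map (algebraMap (ToricRing k σ)
        (Localization.AtPrime (toricMaximalIdeal k σ))) := by
    rw [← monomialIdeal_map_iterateFrobenius, Ideal.map_map, Ideal.map_map]
    congr 1
    exact RingHom.ext fun x => (RingHom.map_iterateFrobenius _ p x n).symm
  have hmax : IsLocalRing.maximalIdeal (Localization.AtPrime (toricMaximalIdeal k σ)) =
      (toricMaximalIdeal k σ).map (algebraMap (ToricRing k σ)
        (Localization.AtPrime (toricMaximalIdeal k σ))) :=
    (Localization.AtPrime.map_eq_maximalIdeal).symm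
  have := toricRing_isNoetherianRing k hσ P
  obtain ⟨e⟩ := nonempty_zerothLocalCohomology_equiv (J := toricMaximalIdeal k σ)
    (Localization.AtPrime (toricMaximalIdeal k σ)) k (IsNoetherian.noetherian _)
    (monomialIdeal k fun i => p ^ n • m i)
  rw [gHKFunction_quotient, hcomm, hmax, ← hrank, e.finrank_eq]
  have := Module.Finite.equiv e
  exact Module.length_eq_finrank_of_forall_exists_pow_smul k _
    (exists_sub_algebraMap_mem_map (J := toricMaximalIdeal k σ) _ k
      fun f => ⟨_, sub_algebraMap_mem_toricMaximalIdeal hσ f⟩) _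
    (pow_smul_zerothLocalCohomology _)

theorem tendsto_card_locusDiff (p : ℕ) (hp : 1 < p) (m : Fin s → coneMonoid σ)
    (P : ConePresentation σ) (hfull : Submodule.span ℝ (σ : Set (Fin d → ℝ)) = ⊤) :
    Tendsto (fun n : ℕ => (((Nat.card {a : Fin d → ℤ //
        ((p ^ n : ℕ) : ℝ)⁻¹ • latticeEmbedding d a ∈ locusDiff m} : ℕ∞) : ℝ≥0∞)) /
      (p : ℝ≥0∞) ^ (n * d)) atTop (𝓝 (volume (locusDiff m))) := by
  obtain ⟨H, hH⟩ := P.exists_isDeterminedBy hfull m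
  have hb := P.isBounded_locus_diff hfull m
  have h1 := (hH.tendsto_card hb).comp (tendsto_pow_atTop_atTop_of_one_lt hp)
  have h2 := ENNReal.tendsto_ofReal h1
  rw [measureReal_def, ENNReal.ofReal_toReal hb.measure_lt_top.ne] at h2
  refine h2.congr fun n => ?_
  have hpos : (0 : ℝ) < (p : ℝ) ^ (n * d) := pow_pos (by exact_mod_cast (by omega : 0 < p)) _
  simp only [Function.comp_apply]
  have hpow : ((p ^ n : ℕ) : ℝ) ^ d = (p : ℝ) ^ (n * d) := by rw [Nat.cast_pow, ← pow_mul]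
  rw [hpow, ENNReal.ofReal_div_of_pos hpos, ENNReal.ofReal_natCast,
    ENNReal.ofReal_pow (Nat.cast_nonneg p), ENNReal.ofReal_natCast, ENat.toENNReal_coe]
  rfl

end Multiplicity

/-- `D = (LC_I ∩ σ) \ W_I` is `LC_I \ W_I` itself as soon as `d ≠ 1`, by the first conjunct. The
multiplicity is taken both over `k[σ ∩ M]`, with its maximal ideal `J`, and over the local ring of
`k[σ ∩ M]` at `J`. -/
theorem theorem4p4 (p : ℕ) [Fact p.Prime] (k : Type*) [Field k] [CharP k p]
    (d : ℕ) (σ : PointedCone ℝ (Fin d → ℝ))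
    (hrational : IsRationalPolyhedralCone σ)
    (hstrongly : (σ : ConvexCone ℝ (Fin d → ℝ)).Salient)
    (hfull : Submodule.span ℝ (σ : Set (Fin d → ℝ)) = ⊤)
    (s : ℕ) (m : Fin s → coneMonoid σ)
    (I : Ideal (ToricRing k σ)) (hI : I = monomialIdeal k m)
    (D : Set (Fin d → ℝ))
    (hD : D = (finiteColengthLocus m ∩ (σ : Set (Fin d → ℝ))) \ coneUnion m) :
    (d ≠ 1 → finiteColengthLocus m ⊆ (σ : Set (Fin d → ℝ))) ∧
    Bornology.IsBounded D ∧
    HasGHKMultiplicity p (ToricRing k σ) (toricMaximalIdeal k σ) (ToricRing k σ ⧸ I) (volume D) ∧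
    (∃ _hJ : (toricMaximalIdeal k σ).IsMaximal,
      HasGHKMultiplicity p (Localization.AtPrime (toricMaximalIdeal k σ))
        (IsLocalRing.maximalIdeal (Localization.AtPrime (toricMaximalIdeal k σ)))
        (Localization.AtPrime (toricMaximalIdeal k σ) ⧸
          I.map (algebraMap (ToricRing k σ) (Localization.AtPrime (toricMaximalIdeal k σ))))
        (volume D)) ∧
    (∃ r : NNRat, volume D = ((r : NNReal) : ℝ≥0∞)) := by

  classical
  obtain ⟨P⟩ := hrational.nonempty_presentation
  subst hI
  change D = locusDiff m at hD
  subst hD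
  have hp : p.Prime := Fact.out
  have hlim := tendsto_card_locusDiff p hp.one_lt m P hfull
  obtain ⟨H, hH⟩ := P.exists_isDeterminedBy hfull m
  have hb : Bornology.IsBounded (locusDiff m) := P.isBounded_locus_diff hfull m
  have hJ := toricMaximalIdeal_isMaximal (k := k) hstrongly
  refine ⟨fun hd => P.locus_subset hfull hd, hb, ⟨d, ringKrullDim_toricRing hstrongly P hfull, ?_⟩,
    ⟨hJ, d, ?_, ?_⟩, hH.exists_rat_volume hb⟩
  · refine hlim.congr fun n => ?_
    rw [gHKFunction_toricRing p hp.pos m P hstrongly hfull]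
  · rw [IsLocalization.AtPrime.ringKrullDim_eq_height (toricMaximalIdeal k σ),
      height_toricMaximalIdeal hstrongly P hfull]
    rfl
  · refine hlim.congr fun n => ?_
    rw [gHKFunction_localization p hp.pos m P hstrongly hfull]
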